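/- Let $D=\{[2^jk,2^j(k+1)) : j,k\in\mathbb Z\}$ be the dyadic intervals of $\mathbb R$. For $I\in D$ let $I^+,I^-$ be its left and right halves, let $h_I=|I|^{-1/2}(\chi_{I^+}-\chi_{I^-})$ be its Haar function, and let $m_If=\frac1{|I|}\int_I f$. Test functions are the finite real linear combinations of indicators $\chi_I$, $I\in D$. A perfect dyadic operator is a linear map $T$ from test functions to linear functionals on test functions, $g\mapsto\langle Tf,g\rangle$, such that there is a kernel $K:\mathbb R\times\mathbb R\to\mathbb R$ with (a) $|K(x,y)|\le\frac1{|x-y|}$ for $x\ne y$; (b) $|K(x,y)-K(x,y')|+|K(x,y)-K(x',y)|=0$ whenever $x,x'\in I\in D$, $y,y'\in J\in D$ and $I\cap J=\varnothing$; (c) $Tf(x)=\int K(x,y)f(y)\,dy$ for $x\notin\operatorname{supp}f$, in the sense that $\langle Tf,g\rangle=\int g(x)\int K(x,y)f(y)\,dy\,dx$ for all test functions $f,g$ with disjoint supports $\{f\neq 0\}$, $\{g\neq 0\}$. The adjoint is given by $\langle T^*f,g\rangle=\langle Tg,f\rangle$. The Haar coefficients of $T(1)$ and $T^*(1)$ are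 $\langle T(1),h_I\rangle=\langle T\chi_I,h_I\rangle$ and $\langle T^*(1),h_I\rangle=\langle T^*\chi_I,h_I\rangle$; by (b) and (c), $\chi_I$ can be replaced here by any test function equal to $1$ on $I$. Put $$\|b\|_{BMO^d}=\sup_{J\in D}\Big(\frac1{|J|}\sum_{I\in D,\,I\subseteq J}\langle b,h_I\rangle^2\Big)^{1/2}.$$ A weight is a locally integrable function that is positive almost everywhere. The class $A_2^d$ consists of the weights $w$ such that $w^{-1}$ is a weight and $[w]_{A_2^d}=\sup_{I\in D}m_Iw\;m_I(w^{-1})<\infty$. **Theorem (weighted $T(1)$ theorem).** There is an absolute constant $C$ such that the following holds. Let $T$ be a perfect dyadic operator and let $Q$ be a real number with $$\|T(1)\|_{BMO^d}\le Q,\qquad \|T^*(1)\|_{BMO^d}\le Q,\qquad |\langle Th_I,h_I\rangle|\le Q\quad\text{for all } I\in D.$$ Then for every $w\in A_2^d$ the operator $T$ extends uniquely to a bounded linear operator on $L^2(w)$ satisfying $$\|Tf\|_{L^2(w)}\le C\,Q\,[w]_{A_2^d}\,\|f\|_{L^2(w)}\qquad\text{for all } f\in L^2(w).$$ Here "extends"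 means that for all test functions $f,g$ the function $(Tf)\,g$ is integrable and $\langle Tf,g\rangle=\int (Tf)(x)\,g(x)\,dx$. -/

import Mathlib

open Set MeasureTheory

open scoped ENNReal

noncomputable section

namespace PerfectDyadic

/-- The dyadic interval `[2 ^ j * k, 2 ^ j * (k + 1))` is encoded by the pair `(j, k)`. -/
@[ext]
structure DyadicInterval where
  j : ℤ
  k : ℤ

namespace DyadicInterval

/-- The underlying half-open interval. -/
def toSet (I : DyadicInterval) : Set ℝ :=
  Ico ((2 : ℝ) ^ I.j * I.k) ((2 : ℝ) ^ I.j * (I.k + 1))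

/-- The length `|I|`. -/
def length (I : DyadicInterval) : ℝ := (2 : ℝ) ^ I.j

/-- The left half of `I` (called `I⁺`). -/
def left (I : DyadicInterval) : DyadicInterval := ⟨I.j - 1, 2 * I.k⟩

/-- The right half of `I` (called `I⁻`). -/
def right (I : DyadicInterval) : DyadicInterval := ⟨I.j - 1, 2 * I.k + 1⟩

end DyadicInterval

/-- The test functions: finite linear combinations of indicators of dyadic intervals. -/
def dyadicStep : Submodule ℝ (ℝ → ℝ) :=
  Submodule.span ℝ (range fun I : DyadicInterval => I.toSet.indicator (fun _ => (1 : ℝ)))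

/-- The indicator `χ_I` as a test function. -/
def ind (I : DyadicInterval) : dyadicStep :=
  ⟨I.toSet.indicator (fun _ => (1 : ℝ)), Submodule.subset_span ⟨I, rfl⟩⟩

/-- The Haar function `h_I = |I| ^ (-1/2) * (χ_{I⁺} - χ_{I⁻})`. -/
def haar (I : DyadicInterval) : dyadicStep :=
  (Real.sqrt I.length)⁻¹ • (ind I.left - ind I.right)

/-- A linear operator from test functions to distributions, i.e. to linear functionals on test
functions. For `T : DyadicOperator` the number `T f g` is the pairing `⟨T f, g⟩`.  The adjoint
`T*`, with `⟨T* f, g⟩ = ⟨T g, f⟩`, is `LinearMap.flip T`. -/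
abbrev DyadicOperator : Type := dyadicStep →ₗ[ℝ] dyadicStep →ₗ[ℝ] ℝ

/-- `K` satisfies the standard size condition (with constant `1`) and the perfect dyadic
cancellation condition. -/
structure IsPerfectDyadicKernel (K : ℝ → ℝ → ℝ) : Prop where
  size : ∀ x y : ℝ, x ≠ y → |K x y| ≤ 1 / |x - y|
  cancel : ∀ I J : DyadicInterval, Disjoint I.toSet J.toSet →
    ∀ x ∈ I.toSet, ∀ x' ∈ I.toSet, ∀ y ∈ J.toSet, ∀ y' ∈ J.toSet,
      |K x y - K x y'| + |K x y - K x' y| = 0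

/-- `T f (x) = ∫ K (x, y) f y dy` off the support of `f`: this is tested against all `g` whose
support is disjoint from that of `f`. -/
def HasKernel (T : DyadicOperator) (K : ℝ → ℝ → ℝ) : Prop :=
  ∀ f g : dyadicStep, Disjoint (Function.support (f : ℝ → ℝ)) (Function.support (g : ℝ → ℝ)) →
    T f g = ∫ x, (∫ y, K x y * (f : ℝ → ℝ) y) * (g : ℝ → ℝ) x

/-- Perfect dyadic operators on the real line. -/
def IsPerfectDyadicOperator (T : DyadicOperator) : Prop :=
  ∃ K : ℝ → ℝ → ℝ, IsPerfectDyadicKernel K ∧ HasKernel T K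

/-- The Haar coefficient `⟨T 1, h_I⟩`, defined as `⟨T χ_I, h_I⟩`. For a perfect dyadic operator and
its adjoint `χ_I` may be replaced by any test function that equals `1` on `I`, however large its
support, see `oneCoeff_eq` and `oneCoeff_flip_eq`. -/
def oneCoeff (T : DyadicOperator) (I : DyadicInterval) : ℝ := T (ind I) (haar I)

/-- The dyadic `BMO` norm of a function with Haar coefficients `b I`:
the supremum over dyadic `J` of `(|J|⁻¹ * ∑_{I ⊆ J} (b I) ^ 2) ^ (1/2)`, possibly infinite. -/
def bmoNorm (b : DyadicInterval → ℝ) : ℝ≥0∞ :=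
  ⨆ J : DyadicInterval,
    ((∑' I : {I : DyadicInterval // I.toSet ⊆ J.toSet}, ENNReal.ofReal ((b I) ^ 2)) /
      ENNReal.ofReal J.length) ^ (1 / 2 : ℝ)

/-- A weight: locally integrable and positive almost everywhere. -/
def IsWeight (w : ℝ → ℝ) : Prop :=
  LocallyIntegrable w volume ∧ ∀ᵐ x : ℝ, 0 < w x

/-- The average `m_I f`. -/
def avg (I : DyadicInterval) (f : ℝ → ℝ) : ℝ := I.length⁻¹ * ∫ x in I.toSet, f x

/-- The dyadic Muckenhoupt class `A₂ᵈ`. -/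
structure IsA2 (w : ℝ → ℝ) : Prop where
  weight : IsWeight w
  weight_inv : IsWeight (fun x => (w x)⁻¹)
  bdd : BddAbove (range fun I : DyadicInterval => avg I w * avg I (fun x => (w x)⁻¹))

/-- The `A₂ᵈ` characteristic `[w]`. -/
def A2const (w : ℝ → ℝ) : ℝ :=
  ⨆ I : DyadicInterval, avg I w * avg I (fun x => (w x)⁻¹)

/-- The measure `w(x) dx`. -/
def weightMeasure (w : ℝ → ℝ) : Measure ℝ :=
  volume.withDensity fun x => ENNReal.ofReal (w x)

/-- The bounded operator `U` of `L²(w)` extends `T`: every test function `f` lies in `L²(w)`, and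
the distribution `T f` is the locally integrable function `U f`. -/
def Extends (w : ℝ → ℝ) (U : Lp ℝ 2 (weightMeasure w) →L[ℝ] Lp ℝ 2 (weightMeasure w))
    (T : DyadicOperator) : Prop :=
  ∀ f : dyadicStep, ∃ hf : MemLp (f : ℝ → ℝ) 2 (weightMeasure w), ∀ g : dyadicStep,
    Integrable (fun x => U (hf.toLp f) x * (g : ℝ → ℝ) x) volume ∧
      T f g = ∫ x, U (hf.toLp f) x * (g : ℝ → ℝ) x

/-! ### `⟨T 1, h_I⟩` does not depend on how `1` is cut off outside `I` -/

lemma DyadicInterval.exists_small_mem (I : DyadicInterval) (y : ℝ) (hy : y ∉ I.toSet) :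
    ∃ J : DyadicInterval, y ∈ J.toSet ∧ Disjoint I.toSet J.toSet := by
  have h2 : (0 : ℝ) < (2 : ℝ) ^ I.j := by positivity
  refine ⟨⟨I.j, ⌊y / (2 : ℝ) ^ I.j⌋⟩, ?_, ?_⟩
  · have h1 := Int.floor_le (y / (2 : ℝ) ^ I.j)
    have h3 := Int.lt_floor_add_one (y / (2 : ℝ) ^ I.j)
    rw [le_div_iff₀ h2] at h1
    rw [div_lt_iff₀ h2] at h3
    exact ⟨by simp only; linarith, by simp only; linarith⟩
  · rw [Set.disjoint_left]
    rintro x ⟨hx1, hx2⟩ ⟨hx3, hx4⟩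
    simp only at hx3 hx4
    have ha : ((I.k : ℤ) : ℝ) < (⌊y / (2 : ℝ) ^ I.j⌋ : ℝ) + 1 :=
      lt_of_mul_lt_mul_left (lt_of_le_of_lt hx1 hx4) h2.le
    have hb : (⌊y / (2 : ℝ) ^ I.j⌋ : ℝ) < (I.k : ℝ) + 1 :=
      lt_of_mul_lt_mul_left (lt_of_le_of_lt hx3 hx2) h2.le
    have hk : ⌊y / (2 : ℝ) ^ I.j⌋ = I.k := by
      have ha' : I.k < ⌊y / (2 : ℝ) ^ I.j⌋ + 1 := by exact_mod_cast ha
      have hb' : ⌊y / (2 : ℝ) ^ I.j⌋ < I.k + 1 := by exact_mod_cast hb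
      omega
    rw [Int.floor_eq_iff, le_div_iff₀ h2, div_lt_iff₀ h2] at hk
    exact hy ⟨by linarith [hk.1], by linarith [hk.2]⟩

lemma haar_apply (I : DyadicInterval) (x : ℝ) :
    (haar I : ℝ → ℝ) x = (Real.sqrt I.length)⁻¹ *
      (I.left.toSet.indicator (fun _ => (1 : ℝ)) x - I.right.toSet.indicator (fun _ => 1) x) := by
  simp [haar, ind]

lemma DyadicInterval.half (I : DyadicInterval) :
    (2 : ℝ) ^ I.j = 2 * (2 : ℝ) ^ (I.j - 1) := by
  rw [zpow_sub_one₀ (by norm_num)]; ring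

lemma DyadicInterval.left_subset (I : DyadicInterval) : I.left.toSet ⊆ I.toSet := by
  have h2 : (0 : ℝ) < (2 : ℝ) ^ (I.j - 1) := by positivity
  rintro x ⟨h1, h3⟩
  simp only [left] at h1 h3
  push_cast at h1 h3
  refine ⟨?_, ?_⟩ <;> rw [I.half] <;> nlinarith

lemma DyadicInterval.right_subset (I : DyadicInterval) : I.right.toSet ⊆ I.toSet := by
  have h2 : (0 : ℝ) < (2 : ℝ) ^ (I.j - 1) := by positivity
  rintro x ⟨h1, h3⟩
  simp only [right] at h1 h3
  push_cast at h1 h3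
  refine ⟨?_, ?_⟩ <;> rw [I.half] <;> nlinarith

lemma haar_eq_zero (I : DyadicInterval) {x : ℝ} (hx : x ∉ I.toSet) : (haar I : ℝ → ℝ) x = 0 := by
  rw [haar_apply, Set.indicator_of_notMem (fun h => hx (I.left_subset h)),
    Set.indicator_of_notMem (fun h => hx (I.right_subset h))]
  simp

lemma integral_ind (I : DyadicInterval) :
    ∫ x, I.toSet.indicator (fun _ => (1 : ℝ)) x = I.length := by
  have h2 : (0 : ℝ) < (2 : ℝ) ^ I.j := by positivity
  rw [integral_indicator (by exact measurableSet_Ico)]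
  simp only [integral_const, smul_eq_mul, mul_one, DyadicInterval.toSet, DyadicInterval.length,
    measureReal_restrict_apply_univ, Real.volume_real_Ico]
  rw [max_eq_left (by nlinarith)]
  ring

lemma integrable_ind (I : DyadicInterval) :
    Integrable (I.toSet.indicator (fun _ => (1 : ℝ))) volume := by
  refine (integrable_indicator_iff (by exact measurableSet_Ico)).2 ?_
  exact integrableOn_const (by simp [DyadicInterval.toSet])

lemma integral_haar (I : DyadicInterval) : ∫ x, (haar I : ℝ → ℝ) x = 0 := by
  simp only [haar_apply]
  rw [integral_const_mul, integral_sub (integrable_ind _) (integrable_ind _),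
    integral_ind, integral_ind]
  simp [DyadicInterval.left, DyadicInterval.right, DyadicInterval.length]

lemma DyadicInterval.nonempty (I : DyadicInterval) : I.toSet.Nonempty := by
  have h2 : (0 : ℝ) < (2 : ℝ) ^ I.j := by positivity
  exact ⟨(2 : ℝ) ^ I.j * I.k, le_rfl, by nlinarith⟩

lemma disjoint_support_haar {I : DyadicInterval} {g : ℝ → ℝ} (hg : ∀ x ∈ I.toSet, g x = 0) :
    Disjoint (Function.support g) (Function.support (haar I : ℝ → ℝ)) := by
  rw [Set.disjoint_left]
  intro x hx hx'
  by_cases h : x ∈ I.toSet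
  · exact hx (hg x h)
  · exact hx' (haar_eq_zero I h)

lemma pairing_haar_eq_zero {T : DyadicOperator} (hT : IsPerfectDyadicOperator T)
    (I : DyadicInterval) (g : dyadicStep) (hg : ∀ x ∈ I.toSet, (g : ℝ → ℝ) x = 0) :
    T g (haar I) = 0 := by
  obtain ⟨K, hK, hTK⟩ := hT
  rw [hTK g (haar I) (disjoint_support_haar hg)]
  obtain ⟨x₀, hx₀⟩ := I.nonempty
  have key : ∀ x, (∫ y, K x y * (g : ℝ → ℝ) y) * (haar I : ℝ → ℝ) x
      = (∫ y, K x₀ y * (g : ℝ → ℝ) y) * (haar I : ℝ → ℝ) x := by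
    intro x
    by_cases hx : x ∈ I.toSet
    · congr 2
      funext y
      by_cases hy : y ∈ I.toSet
      · simp [hg y hy]
      · obtain ⟨J, hyJ, hIJ⟩ := I.exists_small_mem y hy
        have := hK.cancel I J hIJ x hx x₀ hx₀ y hyJ y hyJ
        simp only [sub_self, abs_zero, zero_add, abs_eq_zero] at this
        rw [sub_eq_zero.1 this]
    · simp [haar_eq_zero I hx]
  simp_rw [key]
  rw [integral_const_mul, integral_haar, mul_zero]

lemma haar_pairing_eq_zero {T : DyadicOperator} (hT : IsPerfectDyadicOperator T)
    (I : DyadicInterval) (g : dyadicStep) (hg : ∀ x ∈ I.toSet, (g : ℝ → ℝ) x = 0) :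
    T (haar I) g = 0 := by
  obtain ⟨K, hK, hTK⟩ := hT
  rw [hTK (haar I) g (disjoint_support_haar hg).symm]
  obtain ⟨y₀, hy₀⟩ := I.nonempty
  have key : ∀ x, (∫ y, K x y * (haar I : ℝ → ℝ) y) * (g : ℝ → ℝ) x = 0 := by
    intro x
    by_cases hx : x ∈ I.toSet
    · simp [hg x hx]
    · obtain ⟨J, hxJ, hIJ⟩ := I.exists_small_mem x hx
      have h : ∀ y, K x y * (haar I : ℝ → ℝ) y = K x y₀ * (haar I : ℝ → ℝ) y := by
        intro y
        by_cases hy : y ∈ I.toSet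
        · have := hK.cancel J I hIJ.symm x hxJ x hxJ y hy y₀ hy₀
          simp only [sub_self, abs_zero, add_zero, abs_eq_zero] at this
          rw [sub_eq_zero.1 this]
        · simp [haar_eq_zero I hy]
      simp_rw [h]
      rw [integral_const_mul, integral_haar, mul_zero, zero_mul]
  simp [key]

lemma ind_eq_one {I : DyadicInterval} {x : ℝ} (hx : x ∈ I.toSet) : (ind I : ℝ → ℝ) x = 1 := by
  simp [ind, hx]

theorem oneCoeff_eq {T : DyadicOperator} (hT : IsPerfectDyadicOperator T) (I : DyadicInterval)
    (f : dyadicStep) (hf : ∀ x ∈ I.toSet, (f : ℝ → ℝ) x = 1) :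
    T f (haar I) = oneCoeff T I := by
  have := pairing_haar_eq_zero hT I (f - ind I) (fun x hx => by simp [hf x hx, ind_eq_one hx])
  rw [map_sub, LinearMap.sub_apply, sub_eq_zero] at this
  exact this

theorem oneCoeff_flip_eq {T : DyadicOperator} (hT : IsPerfectDyadicOperator T)
    (I : DyadicInterval) (f : dyadicStep) (hf : ∀ x ∈ I.toSet, (f : ℝ → ℝ) x = 1) :
    T.flip f (haar I) = oneCoeff T.flip I := by
  have := haar_pairing_eq_zero hT I (f - ind I) (fun x hx => by simp [hf x hx, ind_eq_one hx])
  rw [map_sub, sub_eq_zero] at this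
  exact this

end PerfectDyadic

end

/-!
The operator is compared with its Haar expansion, and the expansion is dominated by a sparse form,
all on finite dyadic trees.

**Expansion.** The kernel is constant on products of two different dyadic intervals of the same
length, so `T` has rank one there (`exists_pairing_eq`). Consequently the number
`meanFreePairing T f g I = ⟨T (f χ_I), g χ_I⟩ - m_I f * m_I g * ⟨T χ_I, χ_I⟩` satisfies an exact
recursion (`meanFreePairing_eq`): it is the sum of its values at the two halves of `I` and of
`f_I g_I ⟨T h_I, h_I⟩ + m_I f ⟨T 1, h_I⟩ g_I + m_I g ⟨T* 1, h_I⟩ f_I`, where `f_I = ⟨f, h_I⟩`.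
It vanishes on intervals on which `f` and `g` are constant, hence it is a finite tree sum. For the
large intervals `[0, 2 ^ M)` and `[-2 ^ M, 0)`, the subtracted term and the interaction between the
two half-lines are `O(2 ^ -M)`, because `⟨T χ_I, χ_I⟩ = O(|I|)` (`abs_pairing_ind_le`).

**Weighted estimate of the tree sum** (`treeSum_formTerm_le`). Below a top interval `S`, stop at the
intervals where the average of `|f|` or `|g|` exceeds four times its average over `S`. Over the
intervals that are not stopped, the Haar coefficients are those of bounded functions, and
Cauchy–Schwarz together with the `BMO` bounds gives `128 * Q * m_S |f| * m_S |g| * |S|`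
(`prunedSum_formTerm_le`). The stopped intervals fill at most half of `S`, so `|S|` may be replaced
by twice the length of the remaining part. With `s`, `t` the measures of densities `w⁻¹`, `w` and
`α = ∫_S |f| / s(S)`, `β = ∫_S |g| / t(S)`, the `A₂` condition bounds `m_S |f| * m_S |g|` by
`[w] * α * β`, and on a subinterval `L` one has `α β |L| ≤ (α² s(L) + β² t(L)) / 2`. This is
controlled by the Bellman function `4 ∫_L f² w - 4 α ∫_L |f| + 2 α² s(L)` of the dyadic maximal
theorem. For fixed `α` it is additive in `L`, and it is smallest at `α = ∫_L |f| / s(L)`, so the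
estimates for the stopped intervals, obtained by induction on the depth of the tree, add up.

**Extension.** Since dyadic integrals determine a locally integrable function
(`ae_eq_zero_of_setIntegral_toSet`), the test functions `f`, and the products `g * w⁻¹`, are dense
in `L²(w)`. The inner product with `g * w⁻¹` is the unweighted pairing with `g`, so the bilinear
estimate `abs_pairing_le` yields a unique bounded operator (`exists_unique_operator`).
-/

noncomputable section

namespace PerfectDyadic

/-! ### Sums over dyadic trees and their weighted estimate -/

namespace DyadicInterval

lemma length_pos (I : DyadicInterval) : 0 < I.length := by
  unfold length; positivity

lemma length_left (I : DyadicInterval) : I.left.length = I.length / 2 := by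
  have := I.half
  simp only [length, left] at *; linarith

lemma length_right (I : DyadicInterval) : I.right.length = I.length / 2 := by
  have := I.half
  simp only [length, right] at *; linarith

end DyadicInterval

/-- An interval function that is additive under halving, such as `I ↦ ∫ x in I, f x`. -/
def IsAdditive (μ : DyadicInterval → ℝ) : Prop := ∀ I, μ I = μ I.left + μ I.right

/-- The Haar coefficient `⟨f, h_I⟩` in terms of the integrals `X I = ∫ x in I, f x`. -/
def haarCoeff (X : DyadicInterval → ℝ) (I : DyadicInterval) : ℝ :=
  (Real.sqrt I.length)⁻¹ * (X I.left - X I.right)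

/-- The sum of `a J` over the dyadic `J ⊆ I` with `|J| = 2 ^ (-i) * |I|`, `0 ≤ i < n`. -/
def treeSum (a : DyadicInterval → ℝ) : ℕ → DyadicInterval → ℝ
  | 0, _ => 0
  | n + 1, I => a I + treeSum a n I.left + treeSum a n I.right

open Classical in
/-- The part of `treeSum a n I` over those `J` for which all intervals from `J` up to `I`
satisfy `P`; the maximal intervals violating `P` are the stopped ones. -/
def prunedSum (P : DyadicInterval → Prop) (a : DyadicInterval → ℝ) : ℕ → DyadicInterval → ℝ
  | 0, _ => 0
  | n + 1, I => if P I then a I + prunedSum P a n I.left + prunedSum P a n I.right else 0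

open Classical in
/-- The total length of the `n`-th generation descendants of `I` that are reached from `I` through
intervals satisfying `P`. -/
def keptLength (P : DyadicInterval → Prop) : ℕ → DyadicInterval → ℝ
  | 0, I => I.length
  | n + 1, I => if P I then keptLength P n I.left + keptLength P n I.right else 0

section Sums

variable {P : DyadicInterval → Prop} {a b c : DyadicInterval → ℝ}

lemma prunedSum_nonneg (ha : ∀ I, 0 ≤ a I) (n : ℕ) (I : DyadicInterval) :
    0 ≤ prunedSum P a n I := by
  induction n generalizing I with
  | zero => simp [prunedSum]
  | succ n ih =>
    rw [prunedSum]
    split_ifs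
    · linarith [ha I, ih I.left, ih I.right]
    · rfl

lemma prunedSum_mono (hab : ∀ I, P I → a I ≤ b I) (n : ℕ) (I : DyadicInterval) :
    prunedSum P a n I ≤ prunedSum P b n I := by
  induction n generalizing I with
  | zero => simp [prunedSum]
  | succ n ih =>
    simp only [prunedSum]
    split_ifs with h
    · linarith [hab I h, ih I.left, ih I.right]
    · rfl

lemma treeSum_nonneg (ha : ∀ I, 0 ≤ a I) (n : ℕ) (I : DyadicInterval) : 0 ≤ treeSum a n I := by
  induction n generalizing I with
  | zero => simp [treeSum]
  | succ n ih => rw [treeSum]; linarith [ha I, ih I.left, ih I.right]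

lemma prunedSum_le_treeSum (ha : ∀ I, 0 ≤ a I) (n : ℕ) (I : DyadicInterval) :
    prunedSum P a n I ≤ treeSum a n I := by
  induction n generalizing I with
  | zero => simp [prunedSum, treeSum]
  | succ n ih =>
    rw [prunedSum]
    split_ifs
    · rw [treeSum]; linarith [ih I.left, ih I.right]
    · exact treeSum_nonneg ha _ _

lemma abs_treeSum_le (hab : ∀ I, |a I| ≤ b I) (n : ℕ) (I : DyadicInterval) :
    |treeSum a n I| ≤ treeSum b n I := by
  induction n generalizing I with
  | zero => simp [treeSum]
  | succ n ih =>
    simp only [treeSum]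
    refine (abs_add_three _ _ _).trans ?_
    linarith [hab I, ih I.left, ih I.right]

lemma prunedSum_comb (r s t : ℝ) (n : ℕ) (I : DyadicInterval) :
    prunedSum P (fun J => r * a J + s * b J + t * c J) n I
      = r * prunedSum P a n I + s * prunedSum P b n I + t * prunedSum P c n I := by
  induction n generalizing I with
  | zero => simp [prunedSum]
  | succ n ih =>
    simp only [prunedSum, ih]
    split_ifs
    · ring
    · ring

lemma sq_add_le_mul {u v e₁ e₂ g₁ g₂ : ℝ} (he₁ : 0 ≤ e₁) (he₂ : 0 ≤ e₂) (hg₁ : 0 ≤ g₁)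
    (hg₂ : 0 ≤ g₂) (hu : u ^ 2 ≤ e₁ * g₁) (hv : v ^ 2 ≤ e₂ * g₂) :
    (u + v) ^ 2 ≤ (e₁ + e₂) * (g₁ + g₂) := by
  have h : 2 * (u * v) ≤ e₁ * g₂ + e₂ * g₁ := by
    refine le_of_sq_le_sq ?_ (by positivity)
    have : (u * v) ^ 2 ≤ (e₁ * g₁) * (e₂ * g₂) := by
      rw [mul_pow]; exact mul_le_mul hu hv (sq_nonneg _) (by positivity)
    nlinarith [sq_nonneg (e₁ * g₂ - e₂ * g₁)]
  nlinarith

/-- The Cauchy–Schwarz inequality for pruned sums. -/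
lemma sq_prunedSum_mul_le (n : ℕ) (I : DyadicInterval) :
    (prunedSum P (fun J => a J * b J) n I) ^ 2
      ≤ prunedSum P (fun J => a J ^ 2) n I * prunedSum P (fun J => b J ^ 2) n I := by
  have ha := fun n I => prunedSum_nonneg (P := P) (fun J => sq_nonneg (a J)) n I
  have hb := fun n I => prunedSum_nonneg (P := P) (fun J => sq_nonneg (b J)) n I
  induction n generalizing I with
  | zero => simp [prunedSum]
  | succ n ih =>
    simp only [prunedSum]
    split_ifs
    · exact sq_add_le_mul (add_nonneg (sq_nonneg _) (ha _ _)) (ha _ _)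
        (add_nonneg (sq_nonneg _) (hb _ _)) (hb _ _)
        (sq_add_le_mul (sq_nonneg _) (ha _ _) (sq_nonneg _) (hb _ _)
          (by rw [mul_pow]) (ih _)) (ih _)
    · simp

lemma prunedSum_mul_le {p q : ℝ} (hp : 0 ≤ p) (hq : 0 ≤ q) (n : ℕ) (I : DyadicInterval)
    (ha : prunedSum P (fun J => a J ^ 2) n I ≤ p ^ 2 * I.length)
    (hb : prunedSum P (fun J => b J ^ 2) n I ≤ q ^ 2 * I.length) :
    prunedSum P (fun J => a J * b J) n I ≤ p * q * I.length := by
  have hI := I.length_pos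
  refine le_of_sq_le_sq ?_ (by positivity)
  calc _ ≤ _ := sq_prunedSum_mul_le n I
    _ ≤ (p ^ 2 * I.length) * (q ^ 2 * I.length) :=
      mul_le_mul ha hb (prunedSum_nonneg (fun _ => sq_nonneg _) _ _) (by positivity)
    _ = _ := by ring

end Sums

section Estimate

variable {P : DyadicInterval → Prop} {X x : DyadicInterval → ℝ}

lemma sq_haarCoeff (X : DyadicInterval → ℝ) (I : DyadicInterval) :
    haarCoeff X I ^ 2 = (X I.left - X I.right) ^ 2 / I.length := by
  rw [haarCoeff, mul_pow, inv_pow, Real.sq_sqrt I.length_pos.le]; ring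

/-- The energy of the good part of the Calderón–Zygmund decomposition: as long as the averages
of `|f|` over the intervals in `P` are at most `κ`, the Haar coefficients over these intervals are
those of a function bounded by `2 * κ`. -/
lemma prunedSum_sq_haarCoeff_le (hX : IsAdditive X) (hx : IsAdditive x) (hXx : ∀ I, |X I| ≤ x I)
    {κ : ℝ} (hP : ∀ I, P I → x I ≤ κ * I.length) (n : ℕ) (I : DyadicInterval)
    (hI : |X I| ≤ 2 * κ * I.length) :
    prunedSum P (fun J => |haarCoeff X J| ^ 2) n I ≤ (2 * κ) ^ 2 * I.length := by
  suffices h : X I ^ 2 / I.length + prunedSum P (fun J => |haarCoeff X J| ^ 2) n I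
      ≤ (2 * κ) ^ 2 * I.length by
    have : 0 ≤ X I ^ 2 / I.length := div_nonneg (sq_nonneg _) I.length_pos.le
    linarith
  have key : ∀ I : DyadicInterval, |X I| ≤ 2 * κ * I.length →
      X I ^ 2 / I.length ≤ (2 * κ) ^ 2 * I.length := by
    intro I hI
    rw [div_le_iff₀ I.length_pos, ← sq_abs (X I)]
    have := pow_le_pow_left₀ (abs_nonneg _) hI 2
    linarith [this]
  induction n generalizing I with
  | zero => simpa [prunedSum] using key I hI
  | succ n ih =>
    rw [prunedSum]
    split_ifs with h
    · have h0 := hP I h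
      have h1 := hx I
      have h2 := (abs_nonneg _).trans (hXx I.left)
      have h3 := (abs_nonneg _).trans (hXx I.right)
      have h4 := ih I.left (by rw [I.length_left]; linarith [hXx I.left])
      have h5 := ih I.right (by rw [I.length_right]; linarith [hXx I.right])
      rw [I.length_left] at h4
      rw [I.length_right] at h5
      rw [sq_abs, sq_haarCoeff, hX I]
      have hpos := I.length_pos
      have e : (X I.left + X I.right) ^ 2 / I.length + (X I.left - X I.right) ^ 2 / I.length
          = X I.left ^ 2 / (I.length / 2) + X I.right ^ 2 / (I.length / 2) := by
        field_simp; ring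
      linarith
    · simpa using key I hI

/-- The stopped intervals cover at most half of `S`, when one stops as soon as the average of
`|f|` or of `|g|` exceeds four times its average over `S`. The factor `x S * y S` is kept on both
sides in order not to divide by zero. -/
lemma mul_length_le_keptLength {x y : DyadicInterval → ℝ} (hx : IsAdditive x) (hy : IsAdditive y)
    (hx0 : ∀ I, 0 ≤ x I) (hy0 : ∀ I, 0 ≤ y I) (S : DyadicInterval)
    (hP : ∀ I, ¬ P I → 4 * x S * I.length < x I * S.length ∨
      4 * y S * I.length < y I * S.length) (n : ℕ) :
    x S * y S * S.length ≤ 2 * (x S * y S * keptLength P n S) := by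
  have key : ∀ I, 4 * (x S * y S * (I.length - keptLength P n I))
      ≤ S.length * (x I * y S + x S * y I) := by
    induction n with
    | zero =>
      intro I
      have := mul_nonneg S.length_pos.le
        (add_nonneg (mul_nonneg (hx0 I) (hy0 S)) (mul_nonneg (hx0 S) (hy0 I)))
      simpa [keptLength] using this
    | succ n ih =>
      intro I
      rw [keptLength]
      split_ifs with h
      · have h1 := ih I.left
        have h2 := ih I.right
        rw [hx I, hy I]
        rw [I.length_left] at h1
        rw [I.length_right] at h2
        linarith
      · have hl := S.length_pos
        have hA := mul_nonneg hl.le (mul_nonneg (hx0 S) (hy0 I))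
        have hB := mul_nonneg hl.le (mul_nonneg (hx0 I) (hy0 S))
        rcases hP I h with h | h
        · have := mul_le_mul_of_nonneg_right h.le (hy0 S)
          linarith
        · have := mul_le_mul_of_nonneg_right h.le (hx0 S)
          linarith
  linarith [key S]

/-- The summand of the positive form that dominates `⟨T f, g⟩`. Here `X`, `Y`, `x`, `y` are the
integrals of `f`, `g`, `|f|`, `|g|`, and `b`, `c` are the Haar coefficients of `T 1`, `T* 1`. -/
def formTerm (Q : ℝ) (b c X Y x y : DyadicInterval → ℝ) (I : DyadicInterval) : ℝ :=
  Q * (|haarCoeff X I| * |haarCoeff Y I|) + x I / I.length * (|b I| * |haarCoeff Y I|)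
    + y I / I.length * (|c I| * |haarCoeff X I|)

/-- The contribution of the intervals below `S` that are not stopped. -/
lemma prunedSum_formTerm_le {Q : ℝ} (hQ : 0 ≤ Q) {b c X Y x y : DyadicInterval → ℝ}
    (hX : IsAdditive X) (hY : IsAdditive Y) (hx : IsAdditive x) (hy : IsAdditive y)
    (hXx : ∀ I, |X I| ≤ x I) (hYy : ∀ I, |Y I| ≤ y I)
    (hb : ∀ n I, treeSum (fun J => b J ^ 2) n I ≤ Q ^ 2 * I.length)
    (hc : ∀ n I, treeSum (fun J => c J ^ 2) n I ≤ Q ^ 2 * I.length) (S : DyadicInterval)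
    (hPx : ∀ I, P I → x I * S.length ≤ 4 * x S * I.length)
    (hPy : ∀ I, P I → y I * S.length ≤ 4 * y S * I.length) (n : ℕ) :
    prunedSum P (formTerm Q b c X Y x y) n S ≤ 128 * Q * (x S * y S / S.length) := by
  have hl := S.length_pos
  have hx0 : 0 ≤ x S := (abs_nonneg _).trans (hXx S)
  have hy0 : 0 ≤ y S := (abs_nonneg _).trans (hYy S)
  set κ := 4 * x S / S.length with hκ
  set η := 4 * y S / S.length with hη
  have hκ0 : 0 ≤ κ := by positivity
  have hη0 : 0 ≤ η := by positivity
  have hκS : κ * S.length = 4 * x S := by rw [hκ]; field_simp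
  have hηS : η * S.length = 4 * y S := by rw [hη]; field_simp
  have hPx' : ∀ I, P I → x I ≤ κ * I.length := fun I h => by
    rw [hκ, div_mul_eq_mul_div, le_div_iff₀ hl]; exact hPx I h
  have hPy' : ∀ I, P I → y I ≤ η * I.length := fun I h => by
    rw [hη, div_mul_eq_mul_div, le_div_iff₀ hl]; exact hPy I h
  have ef := prunedSum_sq_haarCoeff_le hX hx hXx hPx' n S (by linarith [hXx S])
  have eg := prunedSum_sq_haarCoeff_le hY hy hYy hPy' n S (by linarith [hYy S])
  have eb : prunedSum P (fun J => |b J| ^ 2) n S ≤ Q ^ 2 * S.length := by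
    simp only [sq_abs]
    exact (prunedSum_le_treeSum (fun J => sq_nonneg _) _ _).trans (hb _ _)
  have ec : prunedSum P (fun J => |c J| ^ 2) n S ≤ Q ^ 2 * S.length := by
    simp only [sq_abs]
    exact (prunedSum_le_treeSum (fun J => sq_nonneg _) _ _).trans (hc _ _)
  have h1 := prunedSum_mul_le (by positivity) (by positivity) n S ef eg
  have h2 := prunedSum_mul_le hQ (by positivity) n S eb eg
  have h3 := prunedSum_mul_le hQ (by positivity) n S ec ef
  calc prunedSum P (formTerm Q b c X Y x y) n S
      ≤ prunedSum P (fun I => Q * (|haarCoeff X I| * |haarCoeff Y I|)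
          + κ * (|b I| * |haarCoeff Y I|) + η * (|c I| * |haarCoeff X I|)) n S := by
        refine prunedSum_mono (fun I hI => ?_) n S
        unfold formTerm
        gcongr
        · rw [div_le_iff₀ I.length_pos]; exact hPx' I hI
        · rw [div_le_iff₀ I.length_pos]; exact hPy' I hI
    _ ≤ Q * (2 * κ * (2 * η) * S.length) + κ * (Q * (2 * η) * S.length)
          + η * (Q * (2 * κ) * S.length) := by
        rw [prunedSum_comb]
        gcongr
    _ = 128 * Q * (x S * y S / S.length) := by
        rw [hκ, hη]; field_simp; ring

/-- The Bellman function of the weighted dyadic maximal theorem. For fixed `A` it is additive in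
the interval, it dominates `A ^ 2 * s`, and it is minimal at `A = x / s`. -/
lemma bellman_ge {x F s : ℝ} (hs : 0 < s) (h : x ^ 2 ≤ F * s) (A : ℝ) :
    A ^ 2 * s ≤ 4 * F - 4 * x * A + 2 * A ^ 2 * s := by
  have h1 : 0 ≤ (2 * x - A * s) ^ 2 := sq_nonneg _
  have h2 : 0 ≤ s * (4 * F - 4 * x * A + A ^ 2 * s) := by nlinarith
  have := nonneg_of_mul_nonneg_right h2 hs
  linarith

lemma bellman_min {x F s : ℝ} (hs : 0 < s) (A : ℝ) :
    4 * F - 2 * x ^ 2 / s ≤ 4 * F - 4 * x * A + 2 * A ^ 2 * s := by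
  have h1 : 0 ≤ 2 * (x - A * s) ^ 2 / s := by positivity
  have : 2 * (x - A * s) ^ 2 / s = 2 * x ^ 2 / s - 4 * x * A + 2 * A ^ 2 * s := by
    field_simp; ring
  linarith

/-- The weighted estimate of the positive form. In the application `F`, `G` are the integrals of
`f ^ 2 * w`, `g ^ 2 * w⁻¹`, while `s`, `t` are those of `w⁻¹`, `w`, and `A` is the `A₂`
characteristic. -/
theorem treeSum_formTerm_le {Q A : ℝ} (hQ : 0 ≤ Q) (hA : 0 ≤ A)
    {b c X Y x y F G s t : DyadicInterval → ℝ}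
    (hX : IsAdditive X) (hY : IsAdditive Y) (hx : IsAdditive x) (hy : IsAdditive y)
    (hF : IsAdditive F) (hG : IsAdditive G) (hs : IsAdditive s) (ht : IsAdditive t)
    (hXx : ∀ I, |X I| ≤ x I) (hYy : ∀ I, |Y I| ≤ y I)
    (hs0 : ∀ I, 0 < s I) (ht0 : ∀ I, 0 < t I)
    (hxF : ∀ I, x I ^ 2 ≤ F I * s I) (hyG : ∀ I, y I ^ 2 ≤ G I * t I)
    (hst : ∀ I, I.length ^ 2 ≤ s I * t I) (hA2 : ∀ I, s I * t I ≤ A * I.length ^ 2)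
    (hb : ∀ n I, treeSum (fun J => b J ^ 2) n I ≤ Q ^ 2 * I.length)
    (hc : ∀ n I, treeSum (fun J => c J ^ 2) n I ≤ Q ^ 2 * I.length) (n : ℕ) (S : DyadicInterval) :
    treeSum (formTerm Q b c X Y x y) n S
      ≤ 128 * Q * A * ((4 * F S - 2 * x S ^ 2 / s S) + (4 * G S - 2 * y S ^ 2 / t S)) := by
  have hx0 : ∀ I, 0 ≤ x I := fun I => (abs_nonneg _).trans (hXx I)
  have hy0 : ∀ I, 0 ≤ y I := fun I => (abs_nonneg _).trans (hYy I)
  have hE : 0 ≤ 128 * Q * A := by positivity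
  set a := formTerm Q b c X Y x y with ha
  induction n using Nat.strong_induction_on generalizing S with
  | _ N ih =>
  have hl := S.length_pos
  set P : DyadicInterval → Prop := fun I =>
    x I * S.length ≤ 4 * x S * I.length ∧ y I * S.length ≤ 4 * y S * I.length with hP
  set α := x S / s S with hα
  set β := y S / t S with hβ
  have hsS := hs0 S
  have htS := ht0 S
  have hα0 : 0 ≤ α := div_nonneg (hx0 S) hsS.le
  have hβ0 : 0 ≤ β := div_nonneg (hy0 S) htS.le
  set B : DyadicInterval → ℝ := fun I =>
    (4 * F I - 4 * x I * α + 2 * α ^ 2 * s I) + (4 * G I - 4 * y I * β + 2 * β ^ 2 * t I) with hB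
  have hBadd : IsAdditive B := fun I => by
    simp only [hB, hF I, hG I, hx I, hy I, hs I, ht I]; ring
  set κ := 256 * Q * (x S * y S / S.length ^ 2) with hκ
  have hκ0 : 0 ≤ κ := by
    have := hx0 S
    have := hy0 S
    positivity
  -- the `A₂` condition on `S`
  have hκA : κ ≤ 256 * Q * A * (α * β) := by
    have h1 := hA2 S
    have h2 : x S * y S = α * β * (s S * t S) := by rw [hα, hβ]; field_simp
    have h3 : x S * y S / S.length ^ 2 ≤ A * (α * β) := by
      rw [div_le_iff₀ (by positivity), h2]
      have := mul_le_mul_of_nonneg_left h1 (mul_nonneg hα0 hβ0)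
      linarith
    rw [hκ]
    have := mul_le_mul_of_nonneg_left h3 (by positivity : 0 ≤ 256 * Q)
    linarith
  have hleaf : ∀ I, κ * I.length ≤ 128 * Q * A * B I := by
    intro I
    have h1 : α * β * I.length ≤ (α ^ 2 * s I + β ^ 2 * t I) / 2 := by
      have hsI := hs0 I
      have htI := ht0 I
      refine le_of_sq_le_sq ?_ (by positivity)
      have := mul_le_mul_of_nonneg_left (hst I) (by positivity : 0 ≤ α ^ 2 * β ^ 2)
      nlinarith [sq_nonneg (α ^ 2 * s I - β ^ 2 * t I)]
    have h2 := bellman_ge (hs0 I) (hxF I) α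
    have h3 := bellman_ge (ht0 I) (hyG I) β
    have h4 : α * β * I.length * 2 ≤ B I := by simp only [hB]; linarith
    calc κ * I.length ≤ 256 * Q * A * (α * β) * I.length :=
          mul_le_mul_of_nonneg_right hκA I.length_pos.le
      _ = 128 * Q * A * (α * β * I.length * 2) := by ring
      _ ≤ _ := mul_le_mul_of_nonneg_left h4 hE
  -- peel off the stopped intervals, to which the induction hypothesis applies
  have hinner : ∀ n, (∀ I, n ≤ N → (n = N → P I) →
      treeSum a n I + κ * keptLength P n I ≤ prunedSum P a n I + 128 * Q * A * B I) := by
    intro n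
    induction n with
    | zero => intro I _ _; simpa [treeSum, prunedSum, keptLength] using hleaf I
    | succ n ihn =>
      intro I hn hI
      by_cases h : P I
      · have h1 := ihn I.left (by omega) (by omega)
        have h2 := ihn I.right (by omega) (by omega)
        rw [treeSum, prunedSum, keptLength, if_pos h, if_pos h, hBadd I]
        linarith
      · rw [prunedSum, keptLength, if_neg h, if_neg h, mul_zero, add_zero, zero_add]
        refine (ih (n + 1) (lt_of_le_of_ne hn fun e => h (hI e)) I).trans ?_
        refine mul_le_mul_of_nonneg_left ?_ hE
        exact add_le_add (bellman_min (hs0 I) α) (bellman_min (ht0 I) β)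
  have hPS : P S := ⟨by nlinarith [hx0 S], by nlinarith [hy0 S]⟩
  have h1 := hinner N S le_rfl fun _ => hPS
  have h2 := prunedSum_formTerm_le (P := P) hQ hX hY hx hy hXx hYy hb hc S (fun I h => h.1)
    (fun I h => h.2) N
  have h3 := mul_length_le_keptLength (P := P) hx hy hx0 hy0 S (fun I h => by
    by_contra! h'; exact h ⟨h'.1, h'.2⟩) N
  have h4 : 128 * Q * (x S * y S / S.length) ≤ κ * keptLength P N S := by
    have e1 : 128 * Q * (x S * y S / S.length)
        = 128 * Q / S.length ^ 2 * (x S * y S * S.length) := by field_simp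
    have e2 : κ * keptLength P N S
        = 128 * Q / S.length ^ 2 * (2 * (x S * y S * keptLength P N S)) := by rw [hκ]; ring
    rw [e1, e2]
    exact mul_le_mul_of_nonneg_left h3 (by positivity)
  have h5 : B S = (4 * F S - 2 * x S ^ 2 / s S) + (4 * G S - 2 * y S ^ 2 / t S) := by
    simp only [hB, hα, hβ]; field_simp; ring
  rw [← h5]
  linarith

end Estimate

/-! ### Test functions and the Haar expansion of the operator -/

namespace DyadicInterval

lemma mem_toSet_iff (I : DyadicInterval) (x : ℝ) : x ∈ I.toSet ↔ ⌊x / (2 : ℝ) ^ I.j⌋ = I.k := by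
  have h2 : (0 : ℝ) < (2 : ℝ) ^ I.j := by positivity
  rw [Int.floor_eq_iff, le_div_iff₀ h2, div_lt_iff₀ h2, toSet, mem_Ico]
  constructor <;> rintro ⟨h1, h3⟩ <;> constructor <;> linarith

lemma measurableSet_toSet (I : DyadicInterval) : MeasurableSet I.toSet := measurableSet_Ico

lemma disjoint_of_j_eq {I J : DyadicInterval} (hj : I.j = J.j) (hk : I.k ≠ J.k) :
    Disjoint I.toSet J.toSet := by
  rw [Set.disjoint_left]
  intro x hx hx'
  rw [mem_toSet_iff] at hx hx'
  rw [hj] at hx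
  exact hk (hx.symm.trans hx')

lemma disjoint_left_right (I : DyadicInterval) : Disjoint I.left.toSet I.right.toSet :=
  disjoint_of_j_eq rfl (by simp [left, right])

lemma left_union_right (I : DyadicInterval) : I.left.toSet ∪ I.right.toSet = I.toSet := by
  refine Subset.antisymm (union_subset I.left_subset I.right_subset) fun x hx => ?_
  have h2 : (0 : ℝ) < (2 : ℝ) ^ (I.j - 1) := by positivity
  obtain ⟨h1, h3⟩ := hx
  rw [I.half] at h1 h3
  rcases lt_or_ge x ((2 : ℝ) ^ (I.j - 1) * (2 * I.k + 1)) with h | h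
  · refine Or.inl ⟨?_, ?_⟩ <;> simp only [left] <;> push_cast <;> linarith
  · refine Or.inr ⟨?_, ?_⟩ <;> simp only [right] <;> push_cast <;> linarith

lemma subset_or_disjoint {I J : DyadicInterval} (h : I.j ≤ J.j) :
    I.toSet ⊆ J.toSet ∨ Disjoint I.toSet J.toSet := by
  obtain ⟨d, hd⟩ := Int.le.dest h
  have key : ∀ x ∈ I.toSet, (x ∈ J.toSet ↔ I.k / ((2 ^ d : ℕ) : ℤ) = J.k) := by
    intro x hx
    rw [mem_toSet_iff] at hx ⊢
    rw [← hd, zpow_add₀ (by norm_num), ← div_div, zpow_natCast, ← hx, ← Int.floor_div_natCast]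
    push_cast
    rfl
  by_cases hk : I.k / ((2 ^ d : ℕ) : ℤ) = J.k
  · exact Or.inl fun x hx => (key x hx).2 hk
  · exact Or.inr (Set.disjoint_left.2 fun x hx hx' => hk ((key x hx).1 hx'))

end DyadicInterval

lemma exists_const_of_j_le (f : dyadicStep) :
    ∃ j₀ : ℤ, ∀ I : DyadicInterval, I.j ≤ j₀ → ∃ c, ∀ x ∈ I.toSet, (f : ℝ → ℝ) x = c := by
  obtain ⟨f, hf⟩ := f
  simp only
  induction hf using Submodule.span_induction with
  | mem f hf =>
    obtain ⟨J, rfl⟩ := hf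
    refine ⟨J.j, fun I hI => ?_⟩
    rcases DyadicInterval.subset_or_disjoint hI with h | h
    · exact ⟨1, fun x hx => by simp [h hx]⟩
    · exact ⟨0, fun x hx => by simp [Set.disjoint_left.1 h hx]⟩
  | zero => exact ⟨0, fun I _ => ⟨0, fun x _ => rfl⟩⟩
  | add f g _ _ hf hg =>
    obtain ⟨i, hi⟩ := hf
    obtain ⟨j, hj⟩ := hg
    refine ⟨min i j, fun I hI => ?_⟩
    obtain ⟨c, hc⟩ := hi I (hI.trans (min_le_left _ _))
    obtain ⟨d, hd⟩ := hj I (hI.trans (min_le_right _ _))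
    exact ⟨c + d, fun x hx => by simp [hc x hx, hd x hx]⟩
  | smul a f _ hf =>
    obtain ⟨i, hi⟩ := hf
    refine ⟨i, fun I hI => ?_⟩
    obtain ⟨c, hc⟩ := hi I hI
    exact ⟨a * c, fun x hx => by simp [hc x hx]⟩

lemma exists_support_subset (f : dyadicStep) :
    ∃ M : ℕ, ∀ x, (f : ℝ → ℝ) x ≠ 0 → |x| < 2 ^ M := by
  obtain ⟨f, hf⟩ := f
  simp only
  induction hf using Submodule.span_induction with
  | mem f hf =>
    obtain ⟨J, rfl⟩ := hf
    obtain ⟨M, hM⟩ := pow_unbounded_of_one_lt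
      (|(2 : ℝ) ^ J.j * J.k| + |(2 : ℝ) ^ J.j * (J.k + 1)|) (one_lt_two (α := ℝ))
    refine ⟨M, fun x hx => lt_of_le_of_lt ?_ hM⟩
    obtain ⟨h1, h2⟩ : x ∈ J.toSet := by
      by_contra h; exact hx (by simp [h])
    rw [abs_le]
    constructor
    · linarith [neg_abs_le ((2 : ℝ) ^ J.j * J.k), abs_nonneg ((2 : ℝ) ^ J.j * (J.k + 1))]
    · linarith [le_abs_self ((2 : ℝ) ^ J.j * (J.k + 1)), abs_nonneg ((2 : ℝ) ^ J.j * J.k)]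
  | zero => exact ⟨0, fun x hx => absurd rfl hx⟩
  | add f g _ _ hf hg =>
    obtain ⟨i, hi⟩ := hf
    obtain ⟨j, hj⟩ := hg
    refine ⟨max i j, fun x hx => ?_⟩
    by_cases h : f x = 0
    · exact (hj x fun h' => hx (by simp [h, h'])).trans_le
        (pow_le_pow_right₀ one_le_two (le_max_right _ _))
    · exact (hi x h).trans_le (pow_le_pow_right₀ one_le_two (le_max_left _ _))
  | smul a f _ hf =>
    obtain ⟨i, hi⟩ := hf
    exact ⟨i, fun x hx => hi x fun h => hx (by simp [h])⟩

lemma measurable_coe (f : dyadicStep) : Measurable (f : ℝ → ℝ) := by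
  obtain ⟨f, hf⟩ := f
  simp only
  induction hf using Submodule.span_induction with
  | mem f hf =>
    obtain ⟨J, rfl⟩ := hf
    exact measurable_const.indicator J.measurableSet_toSet
  | zero => exact measurable_const
  | add f g _ _ hf hg => exact hf.add hg
  | smul a f _ hf => exact hf.const_smul a

lemma integrable_coe (f : dyadicStep) : Integrable (f : ℝ → ℝ) volume := by
  obtain ⟨f, hf⟩ := f
  simp only
  induction hf using Submodule.span_induction with
  | mem f hf =>
    obtain ⟨J, rfl⟩ := hf
    exact integrable_ind J
  | zero => exact integrable_zero _ _ _
  | add f g _ _ hf hg => exact hf.add hg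
  | smul a f _ hf => exact hf.smul a

lemma indicator_mem (I : DyadicInterval) {f : ℝ → ℝ} (hf : f ∈ dyadicStep) :
    I.toSet.indicator f ∈ dyadicStep := by
  induction hf using Submodule.span_induction with
  | mem f hf =>
    obtain ⟨J, rfl⟩ := hf
    have key : ∀ A B : DyadicInterval, A.j ≤ B.j →
        (A.toSet ∩ B.toSet).indicator (fun _ => (1 : ℝ)) ∈ dyadicStep := by
      intro A B h
      rcases DyadicInterval.subset_or_disjoint h with h | h
      · rw [inter_eq_left.2 h]; exact (ind A).2
      · rw [disjoint_iff_inter_eq_empty.1 h, indicator_empty]; exact dyadicStep.zero_mem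
    simp only [Set.indicator_indicator]
    rcases le_total I.j J.j with h | h
    · exact key _ _ h
    · rw [inter_comm]; exact key _ _ h
  | zero => rw [indicator_zero']; exact dyadicStep.zero_mem
  | add f g _ _ hf hg => rw [indicator_add']; exact dyadicStep.add_mem hf hg
  | smul a f _ hf =>
    rw [show I.toSet.indicator (a • f) = a • I.toSet.indicator f from
      indicator_const_smul I.toSet a f]
    exact dyadicStep.smul_mem a hf

/-- The test function `f * χ_I`. -/
def restrict (I : DyadicInterval) (f : dyadicStep) : dyadicStep :=
  ⟨I.toSet.indicator f, indicator_mem I f.2⟩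

lemma restrict_eq_add (I : DyadicInterval) (f : dyadicStep) :
    restrict I f = restrict I.left f + restrict I.right f := by
  ext x
  change I.toSet.indicator (f : ℝ → ℝ) x
    = I.left.toSet.indicator (f : ℝ → ℝ) x + I.right.toSet.indicator (f : ℝ → ℝ) x
  rw [← I.left_union_right, indicator_union_of_disjoint I.disjoint_left_right]

lemma ind_eq_add (I : DyadicInterval) : ind I = ind I.left + ind I.right := by
  ext x
  change I.toSet.indicator (fun _ => (1 : ℝ)) x
    = I.left.toSet.indicator (fun _ => 1) x + I.right.toSet.indicator (fun _ => 1) x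
  rw [← I.left_union_right, indicator_union_of_disjoint I.disjoint_left_right]

lemma integral_restrict (I : DyadicInterval) (f : dyadicStep) :
    ∫ x, (restrict I f : ℝ → ℝ) x = ∫ x in I.toSet, (f : ℝ → ℝ) x :=
  integral_indicator I.measurableSet_toSet

lemma isAdditive_setIntegral {u : ℝ → ℝ}
    (hu : ∀ I : DyadicInterval, IntegrableOn u I.toSet volume) :
    IsAdditive fun I => ∫ x in I.toSet, u x := fun I => by
  simp only
  rw [← I.left_union_right, setIntegral_union I.disjoint_left_right
    I.right.measurableSet_toSet (hu _) (hu _)]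

section Operator

variable {T : DyadicOperator}

/-- Between two different dyadic intervals of the same length the kernel is constant, so there
the operator has rank one. -/
lemma exists_pairing_eq (hT : IsPerfectDyadicOperator T) {I J : DyadicInterval} (hj : I.j = J.j)
    (hk : I.k ≠ J.k) :
    ∃ k : ℝ, |k| ≤ 1 / I.length ∧ ∀ f g : dyadicStep,
      (∀ x ∉ I.toSet, (f : ℝ → ℝ) x = 0) → (∀ x ∉ J.toSet, (g : ℝ → ℝ) x = 0) →
      T f g = k * (∫ x, (f : ℝ → ℝ) x) * ∫ x, (g : ℝ → ℝ) x := by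
  obtain ⟨K, hK, hTK⟩ := hT
  have h2 : (0 : ℝ) < (2 : ℝ) ^ I.j := by positivity
  have hd := DyadicInterval.disjoint_of_j_eq hj hk
  set y₀ := (2 : ℝ) ^ I.j * I.k with hy₀
  set x₀ := (2 : ℝ) ^ J.j * J.k with hx₀
  have hyI : y₀ ∈ I.toSet := ⟨le_rfl, by nlinarith⟩
  have hxJ : x₀ ∈ J.toSet := ⟨le_rfl, by rw [← hj] at *; nlinarith⟩
  refine ⟨K x₀ y₀, ?_, fun f g hf hg => ?_⟩
  · have hne : x₀ ≠ y₀ := fun h => Set.disjoint_left.1 hd hyI (h ▸ hxJ)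
    refine (hK.size _ _ hne).trans (one_div_le_one_div_of_le I.length_pos ?_)
    have e : x₀ - y₀ = (2 : ℝ) ^ I.j * ((J.k - I.k : ℤ) : ℝ) := by
      rw [hx₀, hy₀, ← hj]; push_cast; ring
    have h1 : (1 : ℝ) ≤ |((J.k - I.k : ℤ) : ℝ)| := by
      rw [← Int.cast_abs]
      exact_mod_cast Int.one_le_abs (sub_ne_zero.2 (Ne.symm hk))
    rw [e, abs_mul, abs_of_pos h2, DyadicInterval.length]
    exact le_mul_of_one_le_right h2.le h1
  · have hsupp : Disjoint (Function.support (f : ℝ → ℝ)) (Function.support (g : ℝ → ℝ)) := by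
      refine hd.mono ?_ ?_
      · intro x hx; by_contra h; exact hx (hf x h)
      · intro x hx; by_contra h; exact hx (hg x h)
    rw [hTK f g hsupp]
    have key : ∀ x, (∫ y, K x y * (f : ℝ → ℝ) y) * (g : ℝ → ℝ) x
        = (K x₀ y₀ * ∫ y, (f : ℝ → ℝ) y) * (g : ℝ → ℝ) x := by
      intro x
      by_cases hx : x ∈ J.toSet
      · congr 1
        rw [← integral_const_mul]
        congr 1
        funext y
        by_cases hy : y ∈ I.toSet
        · have h1 := hK.cancel J I hd.symm x hx x₀ hxJ y hy y₀ hyI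
          have h3 := hK.cancel J I hd.symm x hx x₀ hxJ y₀ hyI y₀ hyI
          have h4 : |K x y - K x y₀| = 0 := by
            linarith [abs_nonneg (K x y - K x y₀), abs_nonneg (K x y - K x₀ y)]
          have h5 : |K x y₀ - K x₀ y₀| = 0 := by
            linarith [abs_nonneg (K x y₀ - K x y₀), abs_nonneg (K x y₀ - K x₀ y₀)]
          rw [abs_eq_zero, sub_eq_zero] at h4 h5
          rw [h4, h5]
        · simp [hf y hy]
      · simp [hg x hx]
    simp_rw [key]
    rw [integral_const_mul]

lemma restrict_eq_zero {I : DyadicInterval} (f : dyadicStep) (x : ℝ) (hx : x ∉ I.toSet) :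
    (restrict I f : ℝ → ℝ) x = 0 := indicator_of_notMem hx _

lemma ind_eq_zero {I : DyadicInterval} (x : ℝ) (hx : x ∉ I.toSet) :
    (ind I : ℝ → ℝ) x = 0 := by simp [ind, hx]

/-- The rank one blocks between the two halves of `I`. -/
lemma exists_pairing_halves (hT : IsPerfectDyadicOperator T) (I : DyadicInterval) :
    ∃ k l : ℝ, |k| ≤ 2 / I.length ∧ |l| ≤ 2 / I.length ∧
      (∀ f g : dyadicStep, T (restrict I.left f) (restrict I.right g)
        = k * (∫ x in I.left.toSet, (f : ℝ → ℝ) x) * ∫ x in I.right.toSet, (g : ℝ → ℝ) x) ∧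
      (∀ f g : dyadicStep, T (restrict I.right f) (restrict I.left g)
        = l * (∫ x in I.right.toSet, (f : ℝ → ℝ) x) * ∫ x in I.left.toSet, (g : ℝ → ℝ) x) ∧
      T (ind I.left) (ind I.right) = k * (I.length / 2) * (I.length / 2) ∧
      T (ind I.right) (ind I.left) = l * (I.length / 2) * (I.length / 2) := by
  have hk : I.left.k ≠ I.right.k := by simp [DyadicInterval.left, DyadicInterval.right]
  have hi : ∀ J : DyadicInterval, ∫ x, (ind J : ℝ → ℝ) x = J.length := integral_ind
  obtain ⟨k, hk1, hk2⟩ := exists_pairing_eq hT (I := I.left) (J := I.right) rfl hk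
  obtain ⟨l, hl1, hl2⟩ := exists_pairing_eq hT (I := I.right) (J := I.left) rfl hk.symm
  have e : 1 / (I.length / 2) = 2 / I.length := by
    have := I.length_pos
    field_simp
  rw [I.length_left, e] at hk1
  rw [I.length_right, e] at hl1
  refine ⟨k, l, hk1, hl1, fun f g => ?_, fun f g => ?_, ?_, ?_⟩
  · rw [hk2 _ _ (restrict_eq_zero f) (restrict_eq_zero g), integral_restrict, integral_restrict]
  · rw [hl2 _ _ (restrict_eq_zero f) (restrict_eq_zero g), integral_restrict, integral_restrict]
  · rw [hk2 _ _ ind_eq_zero ind_eq_zero, hi, hi, I.length_left, I.length_right]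
  · rw [hl2 _ _ ind_eq_zero ind_eq_zero, hi, hi, I.length_left, I.length_right]

/-- `⟨T (f χ_I), g χ_I⟩` without its part coming from the averages of `f` and `g` over `I`. -/
def meanFreePairing (T : DyadicOperator) (f g : dyadicStep) (I : DyadicInterval) : ℝ :=
  T (restrict I f) (restrict I g)
    - (∫ x in I.toSet, (f : ℝ → ℝ) x) / I.length * ((∫ x in I.toSet, (g : ℝ → ℝ) x) / I.length)
      * T (ind I) (ind I)

/-- The summand of the expansion of `⟨T f, g⟩` into a Haar multiplier, a paraproduct and the
adjoint of a paraproduct. -/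
def haarTerm (T : DyadicOperator) (f g : dyadicStep) (I : DyadicInterval) : ℝ :=
  haarCoeff (fun J => ∫ x in J.toSet, (f : ℝ → ℝ) x) I
      * haarCoeff (fun J => ∫ x in J.toSet, (g : ℝ → ℝ) x) I * T (haar I) (haar I)
    + (∫ x in I.toSet, (f : ℝ → ℝ) x) / I.length * (oneCoeff T I
      * haarCoeff (fun J => ∫ x in J.toSet, (g : ℝ → ℝ) x) I)
    + (∫ x in I.toSet, (g : ℝ → ℝ) x) / I.length * (oneCoeff T.flip I
      * haarCoeff (fun J => ∫ x in J.toSet, (f : ℝ → ℝ) x) I)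

lemma isAdditive_integral_coe (f : dyadicStep) :
    IsAdditive fun I => ∫ x in I.toSet, (f : ℝ → ℝ) x :=
  isAdditive_setIntegral fun _ => (integrable_coe f).integrableOn

/-- The recursion for the mean-free pairing. The rank one blocks contribute in the same way to
both sides, whatever their coefficients are. -/
lemma meanFreePairing_eq (hT : IsPerfectDyadicOperator T) (f g : dyadicStep)
    (I : DyadicInterval) :
    meanFreePairing T f g I = haarTerm T f g I + meanFreePairing T f g I.left
      + meanFreePairing T f g I.right := by
  obtain ⟨k, l, -, -, h1, h2, h3, h4⟩ := exists_pairing_halves hT I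
  have hl := I.length_pos
  simp only [meanFreePairing, haarTerm, haarCoeff, oneCoeff, LinearMap.flip_apply]
  have hf := isAdditive_integral_coe f I
  have hg := isAdditive_integral_coe g I
  simp only at hf hg
  rw [hf, hg, restrict_eq_add I f,
    restrict_eq_add I g, I.length_left, I.length_right]
  simp only [haar, ind_eq_add I, map_add, map_sub, map_smul, LinearMap.add_apply,
    LinearMap.sub_apply, LinearMap.smul_apply, smul_eq_mul, h1, h2, h3, h4]
  obtain ⟨r, hr, hrI⟩ : ∃ r : ℝ, 0 < r ∧ I.length = r ^ 2 :=
    ⟨_, Real.sqrt_pos.2 hl, (Real.sq_sqrt hl.le).symm⟩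
  rw [hrI, Real.sqrt_sq hr.le]
  field_simp
  ring

lemma meanFreePairing_eq_treeSum (hT : IsPerfectDyadicOperator T) {f g : dyadicStep} {j₀ : ℤ}
    (hf : ∀ I : DyadicInterval, I.j ≤ j₀ → ∃ c, ∀ x ∈ I.toSet, (f : ℝ → ℝ) x = c)
    (hg : ∀ I : DyadicInterval, I.j ≤ j₀ → ∃ c, ∀ x ∈ I.toSet, (g : ℝ → ℝ) x = c)
    (n : ℕ) (I : DyadicInterval) (hI : I.j ≤ j₀ + n) :
    meanFreePairing T f g I = treeSum (haarTerm T f g) n I := by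
  induction n generalizing I with
  | zero =>
    have key : ∀ u : dyadicStep, (∃ c, ∀ x ∈ I.toSet, (u : ℝ → ℝ) x = c) →
        restrict I u = ((∫ x in I.toSet, (u : ℝ → ℝ) x) / I.length) • ind I := by
      rintro u ⟨c, hc⟩
      have h1 : restrict I u = c • ind I := by
        ext x
        by_cases hx : x ∈ I.toSet <;> simp [restrict, ind, hx, hc]
      have h2 : (∫ x in I.toSet, (u : ℝ → ℝ) x) = c * I.length := by
        rw [← integral_restrict, h1, ← integral_ind, ← integral_const_mul]
        rfl
      rw [h1, h2, mul_div_cancel_right₀ _ I.length_pos.ne']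
    simp only [Nat.cast_zero, add_zero] at hI
    rw [treeSum, meanFreePairing, key f (hf I hI), key g (hg I hI)]
    simp only [map_smul, LinearMap.smul_apply, smul_eq_mul]
    ring
  | succ n ih =>
    push_cast at hI
    rw [treeSum, meanFreePairing_eq hT, ih I.left (by simp only [DyadicInterval.left]; omega),
      ih I.right (by simp only [DyadicInterval.right]; omega)]

/-- The diagonal terms grow at most like `|I|`, by the bound for `⟨T h_I, h_I⟩` and the size of
the kernel. -/
lemma abs_pairing_ind_le (hT : IsPerfectDyadicOperator T) {Q : ℝ}
    (hQ : ∀ I : DyadicInterval, |T (haar I) (haar I)| ≤ Q) (I : DyadicInterval) :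
    |T (ind I) (ind I)| ≤ (Q + 2) * I.length := by
  obtain ⟨k, l, hk, hl, -, -, h3, h4⟩ := exists_pairing_halves hT I
  have hd := I.length_pos
  obtain ⟨r, hr, hrI⟩ : ∃ r : ℝ, 0 < r ∧ I.length = r ^ 2 :=
    ⟨_, Real.sqrt_pos.2 hd, (Real.sq_sqrt hd.le).symm⟩
  have e : T (ind I) (ind I) = I.length * T (haar I) (haar I)
      + (k * (I.length ^ 2 / 2) + l * (I.length ^ 2 / 2)) := by
    simp only [haar, ind_eq_add I, map_add, map_sub, map_smul, LinearMap.add_apply,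
      LinearMap.sub_apply, LinearMap.smul_apply, smul_eq_mul, h3, h4]
    rw [hrI, Real.sqrt_sq hr.le]
    field_simp
    ring
  have h1 : ∀ m : ℝ, |m| ≤ 2 / I.length → |m * (I.length ^ 2 / 2)| ≤ I.length := by
    intro m hm
    rw [abs_mul, abs_of_pos (by positivity : 0 < I.length ^ 2 / 2)]
    calc _ ≤ 2 / I.length * (I.length ^ 2 / 2) := by gcongr
      _ = _ := by field_simp
  rw [e]
  refine (abs_add_le _ _).trans ?_
  rw [abs_mul, abs_of_pos hd]
  have := mul_le_mul_of_nonneg_left (hQ I) hd.le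
  linarith [abs_add_le (k * (I.length ^ 2 / 2)) (l * (I.length ^ 2 / 2)), h1 k hk, h1 l hl]

end Operator

/-! ### The weighted bilinear estimate -/

section Weights

open Filter Topology

lemma DyadicInterval.integrableOn_toSet (I : DyadicInterval) {u : ℝ → ℝ}
    (hu : LocallyIntegrable u volume) : IntegrableOn u I.toSet volume :=
  (hu.integrableOn_isCompact isCompact_Icc).mono_set Ico_subset_Icc_self

lemma integrable_mul_coe {u : ℝ → ℝ} (hu : LocallyIntegrable u volume) (g : dyadicStep) :
    Integrable (fun x => u x * (g : ℝ → ℝ) x) volume := by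
  obtain ⟨g, hg⟩ := g
  simp only
  induction hg using Submodule.span_induction with
  | mem g hg =>
    obtain ⟨J, rfl⟩ := hg
    have : (fun x => u x * J.toSet.indicator (fun _ => (1 : ℝ)) x) = J.toSet.indicator u := by
      ext x; by_cases hx : x ∈ J.toSet <;> simp [hx]
    simp only [this]
    exact (integrable_indicator_iff J.measurableSet_toSet).2 (J.integrableOn_toSet hu)
  | zero => simp
  | add f g _ _ hf hg =>
    simp only [Pi.add_apply, mul_add]
    exact hf.add hg
  | smul a f _ hf => simpa [mul_left_comm] using hf.const_mul a

lemma integrable_sq_mul {w : ℝ → ℝ} (hw : LocallyIntegrable w volume) (f : dyadicStep) :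
    Integrable (fun x => (f : ℝ → ℝ) x ^ 2 * w x) volume := by
  refine (integrable_mul_coe (integrable_mul_coe hw f).locallyIntegrable f).congr ?_
  exact Eventually.of_forall fun x => by ring

/-- The Cauchy–Schwarz inequality for the factorization `|h| = (|h| * w ^ (1/2)) * w ^ (-1/2)`. -/
lemma sq_integral_abs_le {μ : Measure ℝ} {h w : ℝ → ℝ} (hw : ∀ᵐ x ∂μ, 0 < w x)
    (i1 : Integrable (fun x => h x ^ 2 * w x) μ) (i2 : Integrable (fun x => |h x|) μ)
    (i3 : Integrable (fun x => (w x)⁻¹) μ) :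
    (∫ x, |h x| ∂μ) ^ 2 ≤ (∫ x, h x ^ 2 * w x ∂μ) * ∫ x, (w x)⁻¹ ∂μ := by
  -- integrate `0 ≤ (|h| * w - t) ^ 2 * w⁻¹` and take the discriminant in `t`
  have key : ∀ t : ℝ, 0 ≤ (∫ x, (w x)⁻¹ ∂μ) * (t * t) + (-2 * ∫ x, |h x| ∂μ) * t
      + ∫ x, h x ^ 2 * w x ∂μ := by
    intro t
    have h1 : 0 ≤ ∫ x, (t * t) * (w x)⁻¹ + (-2 * t) * |h x| + h x ^ 2 * w x ∂μ := by
      refine integral_nonneg_of_ae ?_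
      filter_upwards [hw] with x hx
      have : (t * t) * (w x)⁻¹ + (-2 * t) * |h x| + h x ^ 2 * w x
          = (|h x| * w x - t) ^ 2 * (w x)⁻¹ := by
        rw [← sq_abs (h x)]; field_simp; ring
      rw [Pi.zero_apply, this]
      positivity
    have i4 : Integrable (fun x => (t * t) * (w x)⁻¹ + (-2 * t) * |h x|) μ :=
      (i3.const_mul _).add (i2.const_mul _)
    rw [integral_add i4 i1,
      integral_add (i3.const_mul _) (i2.const_mul _), integral_const_mul, integral_const_mul] at h1
    linarith
  have := discrim_le_zero key
  rw [discrim] at this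
  linarith

lemma setIntegral_toSet_pos (I : DyadicInterval) {w : ℝ → ℝ} (hw : IsWeight w) :
    0 < ∫ x in I.toSet, w x := by
  have h0 : ∀ᵐ x ∂volume.restrict I.toSet, 0 < w x := ae_restrict_of_ae hw.2
  rw [integral_pos_iff_support_of_nonneg_ae (h0.mono fun x hx => hx.le)
    (I.integrableOn_toSet hw.1)]
  have h1 : Function.support w =ᵐ[volume.restrict I.toSet] univ :=
    eventuallyEq_univ.2 (h0.mono fun x hx => hx.ne')
  have h2 := I.length_pos
  have h3 : (volume I.toSet).toReal = I.length := by
    rw [← integral_ind, integral_indicator I.measurableSet_toSet]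
    simp [measureReal_def]
  rw [measure_congr h1, Measure.restrict_apply_univ]
  exact (ENNReal.toReal_pos_iff.1 (h3 ▸ h2)).1

lemma setIntegral_one (I : DyadicInterval) : ∫ _ in I.toSet, (1 : ℝ) = I.length := by
  rw [← integral_ind, integral_indicator I.measurableSet_toSet]

lemma IsA2.mul_le {w : ℝ → ℝ} (hw : IsA2 w) (I : DyadicInterval) :
    (∫ x in I.toSet, (w x)⁻¹) * (∫ x in I.toSet, w x) ≤ A2const w * I.length ^ 2 := by
  have h := le_ciSup hw.bdd I
  have hl := I.length_pos
  simp only [avg] at h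
  rw [← div_le_iff₀ (by positivity)]
  refine le_trans (le_of_eq ?_) h
  field_simp

lemma IsA2.A2const_nonneg {w : ℝ → ℝ} (hw : IsA2 w) : 0 ≤ A2const w := by
  have I : DyadicInterval := ⟨0, 0⟩
  have h1 := setIntegral_toSet_pos I hw.weight
  have h2 := setIntegral_toSet_pos I hw.weight_inv
  have hl := I.length_pos
  exact nonneg_of_mul_nonneg_left ((mul_pos h2 h1).le.trans (hw.mul_le I)) (by positivity)

end Weights

section Carleson

/-- A tree sum runs over distinct intervals, so that it can be compared with the sum in the
definition of the `BMO` norm. -/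
lemma exists_finset_treeSum_eq (n : ℕ) (I : DyadicInterval) :
    ∃ s : Finset DyadicInterval, (∀ J ∈ s, J.toSet ⊆ I.toSet) ∧
      ∀ a : DyadicInterval → ℝ, treeSum a n I = ∑ J ∈ s, a J := by
  classical
  induction n generalizing I with
  | zero => exact ⟨∅, by simp, fun a => by simp [treeSum]⟩
  | succ n ih =>
    obtain ⟨s, hs, hs'⟩ := ih I.left
    obtain ⟨t, ht, ht'⟩ := ih I.right
    have hst : Disjoint s t := by
      rw [Finset.disjoint_left]
      intro J h1 h2
      obtain ⟨z, hz⟩ := J.nonempty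
      exact Set.disjoint_left.1 I.disjoint_left_right (hs J h1 hz) (ht J h2 hz)
    have hI : I ∉ s ∪ t := by
      obtain ⟨z, hz⟩ := I.left.nonempty
      obtain ⟨z', hz'⟩ := I.right.nonempty
      intro h
      rcases Finset.mem_union.1 h with h | h
      · exact Set.disjoint_left.1 I.disjoint_left_right (hs I h (I.right_subset hz')) hz'
      · exact Set.disjoint_left.1 I.disjoint_left_right hz (ht I h (I.left_subset hz))
    refine ⟨insert I (s ∪ t), fun J hJ => ?_, fun a => ?_⟩
    · rcases Finset.mem_insert.1 hJ with rfl | hJ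
      · exact Subset.rfl
      · rcases Finset.mem_union.1 hJ with h | h
        · exact (hs J h).trans I.left_subset
        · exact (ht J h).trans I.right_subset
    · rw [Finset.sum_insert hI, Finset.sum_union hst, treeSum, hs', ht', add_assoc]

lemma treeSum_sq_le_of_bmoNorm_le {b : DyadicInterval → ℝ} {Q : ℝ} (hQ : 0 ≤ Q)
    (hb : bmoNorm b ≤ ENNReal.ofReal Q) (n : ℕ) (I : DyadicInterval) :
    treeSum (fun J => b J ^ 2) n I ≤ Q ^ 2 * I.length := by
  obtain ⟨s, hs, hs'⟩ := exists_finset_treeSum_eq n I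
  have h1 := (le_iSup _ I).trans hb
  have hl := I.length_pos
  rw [one_div, ENNReal.rpow_inv_le_iff (by norm_num), ENNReal.div_le_iff (by simpa using hl)
    ENNReal.ofReal_ne_top] at h1
  rw [hs', ← ENNReal.ofReal_le_ofReal_iff (by positivity),
    ENNReal.ofReal_sum_of_nonneg fun _ _ => sq_nonneg _, ENNReal.ofReal_mul (by positivity),
    ENNReal.ofReal_pow hQ]
  rw [show (2 : ℝ) = (2 : ℕ) by norm_num, ENNReal.rpow_natCast] at h1
  refine le_trans ?_ h1
  rw [← Finset.sum_attach]
  refine le_trans ?_ (ENNReal.sum_le_tsum (s.attach.map ⟨fun J => ⟨J.1, hs J.1 J.2⟩,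
    fun J K h => Subtype.ext (by simpa using h)⟩))
  rw [Finset.sum_map]
  rfl

end Carleson

section Bound

variable {T : DyadicOperator} {Q : ℝ} {w : ℝ → ℝ}

lemma abs_haarTerm_le (hd : ∀ I : DyadicInterval, |T (haar I) (haar I)| ≤ Q) (f g : dyadicStep)
    (I : DyadicInterval) :
    |haarTerm T f g I| ≤ formTerm Q (oneCoeff T) (oneCoeff T.flip)
      (fun I => ∫ x in I.toSet, (f : ℝ → ℝ) x) (fun I => ∫ x in I.toSet, (g : ℝ → ℝ) x)
      (fun I => ∫ x in I.toSet, |(f : ℝ → ℝ) x|) (fun I => ∫ x in I.toSet, |(g : ℝ → ℝ) x|) I := by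
  have hl := I.length_pos
  unfold haarTerm formTerm
  refine (abs_add_three _ _ _).trans ?_
  simp only [abs_mul, abs_div, abs_of_pos hl]
  rw [mul_comm _ |T (haar I) (haar I)|]
  gcongr
  · exact hd I
  · exact abs_integral_le_integral_abs
  · exact abs_integral_le_integral_abs

/-- The weighted estimate of the part of `⟨T f, g⟩` living on one dyadic interval. -/
lemma abs_meanFreePairing_le (hT : IsPerfectDyadicOperator T) (hQ : 0 ≤ Q)
    (hb : bmoNorm (oneCoeff T) ≤ ENNReal.ofReal Q)
    (hc : bmoNorm (oneCoeff T.flip) ≤ ENNReal.ofReal Q)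
    (hd : ∀ I : DyadicInterval, |T (haar I) (haar I)| ≤ Q) (hw : IsA2 w) (f g : dyadicStep)
    (I : DyadicInterval) :
    |meanFreePairing T f g I| ≤ 512 * Q * A2const w *
      ((∫ x in I.toSet, (f : ℝ → ℝ) x ^ 2 * w x)
        + ∫ x in I.toSet, (g : ℝ → ℝ) x ^ 2 * (w x)⁻¹) := by
  -- descend until `f` and `g` are constant
  obtain ⟨i, hi⟩ := exists_const_of_j_le f
  obtain ⟨j, hj⟩ := exists_const_of_j_le g
  rw [meanFreePairing_eq_treeSum hT (j₀ := min i j)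
    (fun J hJ => hi J (hJ.trans (min_le_left _ _)))
    (fun J hJ => hj J (hJ.trans (min_le_right _ _))) (I.j - min i j).toNat I (by omega)]
  refine (abs_treeSum_le (abs_haarTerm_le hd f g) _ I).trans ?_
  have hw1 := hw.weight.1
  have hw2 := hw.weight_inv.1
  have hpos : ∀ J : DyadicInterval, ∀ᵐ x ∂volume.restrict J.toSet, 0 < w x := fun J =>
    ae_restrict_of_ae hw.weight.2
  have hpos' : ∀ J : DyadicInterval, ∀ᵐ x ∂volume.restrict J.toSet, 0 < (w x)⁻¹ := fun J =>
    ae_restrict_of_ae hw.weight_inv.2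
  have h := treeSum_formTerm_le hQ hw.A2const_nonneg (b := oneCoeff T) (c := oneCoeff T.flip)
    (F := fun I => ∫ x in I.toSet, (f : ℝ → ℝ) x ^ 2 * w x)
    (G := fun I => ∫ x in I.toSet, (g : ℝ → ℝ) x ^ 2 * (w x)⁻¹)
    (s := fun I => ∫ x in I.toSet, (w x)⁻¹) (t := fun I => ∫ x in I.toSet, w x)
    (isAdditive_integral_coe f) (isAdditive_integral_coe g)
    (isAdditive_setIntegral fun _ => (integrable_coe f).abs.integrableOn)
    (isAdditive_setIntegral fun _ => (integrable_coe g).abs.integrableOn)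
    (isAdditive_setIntegral fun _ => (integrable_sq_mul hw1 f).integrableOn)
    (isAdditive_setIntegral fun _ => (integrable_sq_mul hw2 g).integrableOn)
    (isAdditive_setIntegral fun J => J.integrableOn_toSet hw2)
    (isAdditive_setIntegral fun J => J.integrableOn_toSet hw1)
    (fun _ => abs_integral_le_integral_abs) (fun _ => abs_integral_le_integral_abs)
    (fun J => setIntegral_toSet_pos J hw.weight_inv) (fun J => setIntegral_toSet_pos J hw.weight)
    (fun J => sq_integral_abs_le (hpos J) (integrable_sq_mul hw1 f).integrableOn
      (integrable_coe f).abs.integrableOn (J.integrableOn_toSet hw2))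
    (fun J => by
      simpa using sq_integral_abs_le (hpos' J) (integrable_sq_mul hw2 g).integrableOn
        (integrable_coe g).abs.integrableOn (by
          simp only [inv_inv]; exact J.integrableOn_toSet hw1))
    (fun J => by
      have := sq_integral_abs_le (h := fun _ => 1) (hpos J)
        (by simp only [one_pow, one_mul]; exact J.integrableOn_toSet hw1)
        (by simp only [abs_one]; exact J.integrableOn_toSet (locallyIntegrable_const 1))
        (J.integrableOn_toSet hw2)
      simpa [setIntegral_one, mul_comm, -integral_const] using this)
    hw.mul_le (treeSum_sq_le_of_bmoNorm_le hQ hb) (treeSum_sq_le_of_bmoNorm_le hQ hc)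
    (I.j - min i j).toNat I
  refine h.trans ?_
  have h1 := setIntegral_toSet_pos I hw.weight
  have h2 := setIntegral_toSet_pos I hw.weight_inv
  have h3 : 0 ≤ 2 * (∫ x in I.toSet, |(f : ℝ → ℝ) x|) ^ 2 / ∫ x in I.toSet, (w x)⁻¹ := by
    positivity
  have h4 : 0 ≤ 2 * (∫ x in I.toSet, |(g : ℝ → ℝ) x|) ^ 2 / ∫ x in I.toSet, w x := by
    positivity
  have hE : 0 ≤ 128 * Q * A2const w := by have := hw.A2const_nonneg; positivity
  have := mul_le_mul_of_nonneg_left (add_nonneg h3 h4) hE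
  linarith

open Filter Topology in
/-- The bilinear estimate in additive form, in the limit of large root intervals. -/
lemma abs_pairing_le_add (hT : IsPerfectDyadicOperator T) (hQ : 0 ≤ Q)
    (hb : bmoNorm (oneCoeff T) ≤ ENNReal.ofReal Q)
    (hc : bmoNorm (oneCoeff T.flip) ≤ ENNReal.ofReal Q)
    (hd : ∀ I : DyadicInterval, |T (haar I) (haar I)| ≤ Q) (hw : IsA2 w) (f g : dyadicStep) :
    |T f g| ≤ 512 * Q * A2const w *
      ((∫ x, (f : ℝ → ℝ) x ^ 2 * w x) + ∫ x, (g : ℝ → ℝ) x ^ 2 * (w x)⁻¹) := by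
  set K := 512 * Q * A2const w with hK
  have hK0 : 0 ≤ K := by have := hw.A2const_nonneg; positivity
  set F := ∫ x, (f : ℝ → ℝ) x ^ 2 * w x with hF
  set G := ∫ x, (g : ℝ → ℝ) x ^ 2 * (w x)⁻¹ with hG
  set p := ∫ x, |(f : ℝ → ℝ) x| with hp
  set q := ∫ x, |(g : ℝ → ℝ) x| with hq
  have hp0 : 0 ≤ p := integral_nonneg fun _ => abs_nonneg _
  have hq0 : 0 ≤ q := integral_nonneg fun _ => abs_nonneg _
  have hint : ∀ (u : dyadicStep) (I : DyadicInterval),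
      |∫ x in I.toSet, (u : ℝ → ℝ) x| ≤ ∫ x, |(u : ℝ → ℝ) x| := fun u I =>
    abs_integral_le_integral_abs.trans
      (setIntegral_le_integral (integrable_coe u).abs (Eventually.of_forall fun _ => abs_nonneg _))
  -- the diagonal blocks
  have hdiag : ∀ I : DyadicInterval, |T (restrict I f) (restrict I g)|
      ≤ K * ((∫ x in I.toSet, (f : ℝ → ℝ) x ^ 2 * w x)
        + ∫ x in I.toSet, (g : ℝ → ℝ) x ^ 2 * (w x)⁻¹) + (Q + 2) * (p * q) / I.length := by
    intro I
    have hl := I.length_pos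
    have h1 := abs_meanFreePairing_le hT hQ hb hc hd hw f g I
    have h2 : |(∫ x in I.toSet, (f : ℝ → ℝ) x) / I.length
        * ((∫ x in I.toSet, (g : ℝ → ℝ) x) / I.length) * T (ind I) (ind I)|
        ≤ (Q + 2) * (p * q) / I.length := by
      rw [abs_mul, abs_mul, abs_div, abs_div, abs_of_pos hl]
      calc _ ≤ p / I.length * (q / I.length) * ((Q + 2) * I.length) := by
            gcongr
            · exact hint f I
            · exact hint g I
            · exact abs_pairing_ind_le hT hd I
        _ = _ := by field_simp
    have h3 : T (restrict I f) (restrict I g) = meanFreePairing T f g I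
        + (∫ x in I.toSet, (f : ℝ → ℝ) x) / I.length
        * ((∫ x in I.toSet, (g : ℝ → ℝ) x) / I.length) * T (ind I) (ind I) := by
      rw [meanFreePairing]; ring
    rw [h3]
    exact (abs_add_le _ _).trans (add_le_add h1 h2)
  -- the off-diagonal blocks
  have hoff : ∀ I J : DyadicInterval, I.j = J.j → I.k ≠ J.k →
      |T (restrict I f) (restrict J g)| ≤ (p * q) / I.length := by
    intro I J hj hk
    have hl := I.length_pos
    obtain ⟨k, hk1, hk2⟩ := exists_pairing_eq hT hj hk
    rw [hk2 _ _ (restrict_eq_zero f) (restrict_eq_zero g), integral_restrict, integral_restrict,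
      abs_mul, abs_mul]
    calc _ ≤ 1 / I.length * p * q := by
          gcongr
          · exact hint f I
          · exact hint g J
      _ = _ := by ring
  obtain ⟨m, hm⟩ := exists_support_subset f
  obtain ⟨n, hn⟩ := exists_support_subset g
  -- the errors vanish as the two root intervals `[0, 2 ^ M)` and `[-2 ^ M, 0)` grow
  have hlim : Tendsto (fun M : ℕ => K * (F + G) + (2 * Q + 6) * (p * q) / 2 ^ M) atTop
      (𝓝 (K * (F + G) + 0)) :=
    tendsto_const_nhds.add (tendsto_const_nhds.div_atTop
      (tendsto_pow_atTop_atTop_of_one_lt one_lt_two))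
  rw [add_zero] at hlim
  refine ge_of_tendsto hlim ?_
  filter_upwards [eventually_ge_atTop (max m n)] with M hM
  set I : DyadicInterval := ⟨M, 0⟩ with hI
  set J : DyadicInterval := ⟨M, -1⟩ with hJ
  have hIl : I.length = 2 ^ M := by simp [hI, DyadicInterval.length]
  have hJl : J.length = 2 ^ M := by simp [hJ, DyadicInterval.length]
  have hdis : Disjoint I.toSet J.toSet := DyadicInterval.disjoint_of_j_eq rfl (by simp [hI, hJ])
  have hmem : ∀ x : ℝ, |x| < 2 ^ M → x ∈ I.toSet ∪ J.toSet := by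
    intro x hx
    rw [abs_lt] at hx
    rcases le_or_gt 0 x with h | h
    · left; simpa [hI, DyadicInterval.toSet, h] using hx.2
    · right
      have := hx.1.le
      simp only [hJ, DyadicInterval.toSet, zpow_natCast]
      push_cast
      exact ⟨by linarith, by linarith⟩
  have hsplit : ∀ u : dyadicStep, (∀ x, (u : ℝ → ℝ) x ≠ 0 → |x| < 2 ^ M) →
      u = restrict I u + restrict J u := by
    intro u hu
    ext x
    change (u : ℝ → ℝ) x = I.toSet.indicator (u : ℝ → ℝ) x + J.toSet.indicator (u : ℝ → ℝ) x
    have := congrFun (indicator_union_of_disjoint hdis (u : ℝ → ℝ)) x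
    rw [← this]
    by_cases hx : (u : ℝ → ℝ) x = 0
    · rw [hx, eq_comm, indicator_apply_eq_zero]; exact fun _ => hx
    · rw [indicator_of_mem (hmem x (hu x hx))]
  have hfs := hsplit f fun x hx => (hm x hx).trans_le
    (pow_le_pow_right₀ one_le_two ((le_max_left _ _).trans hM))
  have hgs := hsplit g fun x hx => (hn x hx).trans_le
    (pow_le_pow_right₀ one_le_two ((le_max_right _ _).trans hM))
  have hsum : ∀ u : ℝ → ℝ, Integrable u volume → (∀ᵐ x, 0 ≤ u x) →
      (∫ x in I.toSet, u x) + (∫ x in J.toSet, u x) ≤ ∫ x, u x := by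
    intro u hu hu0
    rw [← setIntegral_union hdis J.measurableSet_toSet hu.integrableOn hu.integrableOn]
    exact setIntegral_le_integral hu hu0
  have e1 := hsum _ (integrable_sq_mul hw.weight.1 f)
    (hw.weight.2.mono fun x hx => by positivity)
  have e2 := hsum _ (integrable_sq_mul hw.weight_inv.1 g)
    (hw.weight_inv.2.mono fun x hx => by positivity)
  have hTfg : T f g = T (restrict I f) (restrict I g) + T (restrict I f) (restrict J g)
      + (T (restrict J f) (restrict I g) + T (restrict J f) (restrict J g)) := by
    conv_lhs => rw [hfs, hgs]
    simp only [map_add, LinearMap.add_apply]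
    ring
  have b1 := hdiag I
  have b2 := hdiag J
  have b3 := hoff I J rfl (by simp [hI, hJ])
  have b4 := hoff J I rfl (by simp [hI, hJ])
  rw [hIl] at b1 b3
  rw [hJl] at b2 b4
  have e3 := mul_le_mul_of_nonneg_left (add_le_add e1 e2) hK0
  have e4 : (2 * Q + 6) * (p * q) / 2 ^ M
      = 2 * ((Q + 2) * (p * q) / 2 ^ M) + 2 * (p * q / 2 ^ M) := by ring
  rw [hTfg, e4]
  refine (abs_add_le _ _).trans ?_
  refine (add_le_add (abs_add_le _ _) (abs_add_le _ _)).trans ?_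
  linarith

/-- The weighted bilinear estimate. -/
theorem abs_pairing_le (hT : IsPerfectDyadicOperator T) (hQ : 0 ≤ Q)
    (hb : bmoNorm (oneCoeff T) ≤ ENNReal.ofReal Q)
    (hc : bmoNorm (oneCoeff T.flip) ≤ ENNReal.ofReal Q)
    (hd : ∀ I : DyadicInterval, |T (haar I) (haar I)| ≤ Q) (hw : IsA2 w) (f g : dyadicStep) :
    |T f g| ≤ 1024 * Q * A2const w *
      √(∫ x, (f : ℝ → ℝ) x ^ 2 * w x) * √(∫ x, (g : ℝ → ℝ) x ^ 2 * (w x)⁻¹) := by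
  have hA := hw.A2const_nonneg
  have hF : 0 ≤ ∫ x, (f : ℝ → ℝ) x ^ 2 * w x :=
    integral_nonneg_of_ae (hw.weight.2.mono fun x hx => by
      simp only [Pi.zero_apply]; positivity)
  have hG : 0 ≤ ∫ x, (g : ℝ → ℝ) x ^ 2 * (w x)⁻¹ :=
    integral_nonneg_of_ae (hw.weight_inv.2.mono fun x hx => by
      simp only [Pi.zero_apply]; positivity)
  -- replace `f` by `t • f` and optimize in `t`
  have key : ∀ t : ℝ, 0 ≤ (512 * Q * A2const w * ∫ x, (f : ℝ → ℝ) x ^ 2 * w x) * (t * t)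
      + (-|T f g|) * t + 512 * Q * A2const w * ∫ x, (g : ℝ → ℝ) x ^ 2 * (w x)⁻¹ := by
    intro t
    have h := abs_pairing_le_add hT hQ hb hc hd hw (t • f) g
    have e : (∫ x, ((t • f : dyadicStep) : ℝ → ℝ) x ^ 2 * w x)
        = t * t * ∫ x, (f : ℝ → ℝ) x ^ 2 * w x := by
      rw [← integral_const_mul]
      congr 1
      ext x
      simp only [Submodule.coe_smul, Pi.smul_apply, smul_eq_mul]
      ring
    rw [e, map_smul, LinearMap.smul_apply, smul_eq_mul, abs_mul] at h
    have := mul_le_mul_of_nonneg_right (le_abs_self t) (abs_nonneg (T f g))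
    linarith
  have h := discrim_le_zero key
  rw [discrim] at h
  refine le_of_sq_le_sq ?_ (by positivity)
  rw [mul_pow, mul_pow, Real.sq_sqrt hF, Real.sq_sqrt hG]
  linarith

end Bound

/-! ### Extension to `L²(w)` -/

open Filter Topology

/-- A locally integrable function is determined by its integrals over dyadic intervals: this is
the Lebesgue differentiation theorem, a dyadic interval being a closed ball up to a null set. -/
lemma ae_eq_zero_of_setIntegral_toSet {u : ℝ → ℝ} (hu : LocallyIntegrable u volume)
    (h : ∀ I : DyadicInterval, ∫ x in I.toSet, u x = 0) : u =ᵐ[volume] 0 := by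
  filter_upwards [IsUnifLocDoublingMeasure.ae_tendsto_average volume hu 1] with x hx
  set I : ℕ → DyadicInterval := fun n => ⟨-n, ⌊x / (2 : ℝ) ^ (-n : ℤ)⌋⟩ with hI
  have hmem : ∀ n, x ∈ (I n).toSet := fun n => by rw [DyadicInterval.mem_toSet_iff]
  set c : ℕ → ℝ := fun n => (2 : ℝ) ^ (I n).j * (I n).k + (I n).length / 2 with hc
  have hball : ∀ n, Metric.closedBall (c n) ((I n).length / 2)
      = Icc ((2 : ℝ) ^ (I n).j * (I n).k) ((2 : ℝ) ^ (I n).j * ((I n).k + 1)) := by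
    intro n
    rw [Real.closedBall_eq_Icc]
    congr 1 <;> simp only [hc, DyadicInterval.length] <;> ring
  have hδ : Tendsto (fun n => (I n).length / 2) atTop (𝓝[>] 0) := by
    refine tendsto_nhdsWithin_iff.2 ⟨?_, Eventually.of_forall fun n => half_pos (I n).length_pos⟩
    have h1 : Tendsto (fun n : ℕ => ((1 : ℝ) / 2) ^ n / 2) atTop (𝓝 (0 / 2)) :=
      (tendsto_pow_atTop_nhds_zero_of_lt_one (by norm_num) (by norm_num)).div_const 2
    rw [zero_div] at h1
    refine h1.congr fun n => ?_
    simp [hI, DyadicInterval.length]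
  have h1 := hx c (fun n => (I n).length / 2) hδ (Eventually.of_forall fun n => by
    rw [one_mul, hball]; exact Ico_subset_Icc_self (hmem n))
  have h2 : ∀ n, (⨍ y in Metric.closedBall (c n) ((I n).length / 2), u y) = 0 := by
    intro n
    rw [setAverage_eq, hball, ← setIntegral_congr_set Ico_ae_eq_Icc]
    have := h (I n)
    rw [DyadicInterval.toSet] at this
    rw [this, smul_zero]
  simp only [h2] at h1
  exact tendsto_nhds_unique h1 tendsto_const_nhds

section WeightedSpace

variable {w : ℝ → ℝ}

lemma IsWeight.aemeasurable_ofReal (hw : IsWeight w) :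
    AEMeasurable (fun x => ENNReal.ofReal (w x)) volume :=
  hw.1.aestronglyMeasurable.aemeasurable.ennreal_ofReal

lemma IsWeight.absolutelyContinuous (hw : IsWeight w) : volume ≪ weightMeasure w :=
  withDensity_absolutelyContinuous' hw.aemeasurable_ofReal
    (hw.2.mono fun x hx => by simpa using hx)

lemma weightMeasure_absolutelyContinuous (w : ℝ → ℝ) : weightMeasure w ≪ volume :=
  withDensity_absolutelyContinuous _ _

lemma IsWeight.toReal_smul_ae_eq (hw : IsWeight w) (u : ℝ → ℝ) :
    (fun x => (ENNReal.ofReal (w x)).toReal • u x) =ᵐ[volume] fun x => w x * u x :=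
  hw.2.mono fun x hx => by simp [ENNReal.toReal_ofReal hx.le]

lemma IsWeight.integral_weightMeasure (hw : IsWeight w) (u : ℝ → ℝ) :
    ∫ x, u x ∂weightMeasure w = ∫ x, w x * u x := by
  rw [weightMeasure, integral_withDensity_eq_integral_toReal_smul₀ hw.aemeasurable_ofReal
    (by simp)]
  exact integral_congr_ae (hw.toReal_smul_ae_eq u)

lemma IsWeight.integrable_weightMeasure (hw : IsWeight w) {u : ℝ → ℝ} :
    Integrable u (weightMeasure w) ↔ Integrable (fun x => w x * u x) volume := by
  rw [weightMeasure, integrable_withDensity_iff_integrable_smul₀' hw.aemeasurable_ofReal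
    (by simp)]
  exact integrable_congr (hw.toReal_smul_ae_eq u)

lemma IsWeight.memLp_coe (hw : IsWeight w) (f : dyadicStep) :
    MemLp (f : ℝ → ℝ) 2 (weightMeasure w) := by
  rw [memLp_two_iff_integrable_sq (measurable_coe f).aestronglyMeasurable,
    hw.integrable_weightMeasure]
  exact (integrable_sq_mul hw.1 f).congr (Eventually.of_forall fun x => mul_comm _ _)

lemma IsA2.memLp_mul_inv (hw : IsA2 w) (g : dyadicStep) :
    MemLp (fun x => (g : ℝ → ℝ) x * (w x)⁻¹) 2 (weightMeasure w) := by
  have hm : AEStronglyMeasurable (fun x => (g : ℝ → ℝ) x * (w x)⁻¹) (weightMeasure w) :=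
    ((measurable_coe g).aestronglyMeasurable.mul
      hw.weight_inv.1.aestronglyMeasurable).mono_ac (weightMeasure_absolutelyContinuous w)
  rw [memLp_two_iff_integrable_sq hm, hw.weight.integrable_weightMeasure]
  refine (integrable_sq_mul hw.weight_inv.1 g).congr ?_
  filter_upwards [hw.weight.2] with x hx
  field_simp

/-- The class in `L²(w)` of a test function. -/
def IsWeight.toL2 (hw : IsWeight w) : dyadicStep →ₗ[ℝ] Lp ℝ 2 (weightMeasure w) where
  toFun f := (hw.memLp_coe f).toLp
  map_add' f g := MemLp.toLp_add (hw.memLp_coe f) (hw.memLp_coe g)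
  map_smul' c f := MemLp.toLp_const_smul c (hw.memLp_coe f)

/-- The class of `g * w⁻¹` in `L²(w)`. The inner product of `L²(w)` with it is the unweighted
pairing with the test function `g`. -/
def IsA2.dualToL2 (hw : IsA2 w) : dyadicStep →ₗ[ℝ] Lp ℝ 2 (weightMeasure w) where
  toFun g := (hw.memLp_mul_inv g).toLp
  map_add' f g := by
    rw [← MemLp.toLp_add (hw.memLp_mul_inv f) (hw.memLp_mul_inv g)]
    congr 1
    ext x
    simp [add_mul]
  map_smul' c f := by
    rw [RingHom.id_apply, ← MemLp.toLp_const_smul c (hw.memLp_mul_inv f)]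
    congr 1
    ext x
    simp [mul_assoc]

lemma IsWeight.inner_toL2 (hw : IsWeight w) (u : Lp ℝ 2 (weightMeasure w)) (f : dyadicStep) :
    inner ℝ u (hw.toL2 f) = ∫ x, w x * u x * (f : ℝ → ℝ) x := by
  rw [L2.inner_def, hw.integral_weightMeasure]
  refine integral_congr_ae ?_
  filter_upwards [hw.absolutelyContinuous.ae_le (hw.memLp_coe f).coeFn_toLp] with x hx
  change w x * inner ℝ (u x) ((hw.memLp_coe f).toLp _ x) = _
  rw [hx, RCLike.inner_apply, conj_trivial]
  ring

lemma IsA2.inner_dualToL2 (hw : IsA2 w) (u : Lp ℝ 2 (weightMeasure w)) (g : dyadicStep) :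
    inner ℝ u (hw.dualToL2 g) = ∫ x, u x * (g : ℝ → ℝ) x := by
  rw [L2.inner_def, hw.weight.integral_weightMeasure]
  refine integral_congr_ae ?_
  filter_upwards [hw.weight.absolutelyContinuous.ae_le (hw.memLp_mul_inv g).coeFn_toLp,
    hw.weight.2] with x hx hx'
  change w x * inner ℝ (u x) ((hw.memLp_mul_inv g).toLp _ x) = _
  rw [hx, RCLike.inner_apply, conj_trivial]
  field_simp

lemma IsWeight.norm_toL2 (hw : IsWeight w) (f : dyadicStep) :
    ‖hw.toL2 f‖ = √(∫ x, (f : ℝ → ℝ) x ^ 2 * w x) := by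
  rw [norm_eq_sqrt_real_inner, hw.inner_toL2]
  congr 1
  refine integral_congr_ae ?_
  filter_upwards [hw.absolutelyContinuous.ae_le (hw.memLp_coe f).coeFn_toLp] with x hx
  change w x * (hw.memLp_coe f).toLp _ x * _ = _
  rw [hx]
  ring

lemma IsA2.norm_dualToL2 (hw : IsA2 w) (g : dyadicStep) :
    ‖hw.dualToL2 g‖ = √(∫ x, (g : ℝ → ℝ) x ^ 2 * (w x)⁻¹) := by
  rw [norm_eq_sqrt_real_inner, hw.inner_dualToL2]
  congr 1
  refine integral_congr_ae ?_
  filter_upwards [hw.weight.absolutelyContinuous.ae_le (hw.memLp_mul_inv g).coeFn_toLp] with x hx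
  change (hw.memLp_mul_inv g).toLp _ x * _ = _
  rw [hx]
  ring

lemma IsWeight.integrable_sq (hw : IsWeight w) (u : Lp ℝ 2 (weightMeasure w)) :
    Integrable (fun x => w x * u x ^ 2) volume :=
  hw.integrable_weightMeasure.1
    ((memLp_two_iff_integrable_sq (Lp.memLp u).aestronglyMeasurable).1 (Lp.memLp u))

lemma IsWeight.aestronglyMeasurable_coe (hw : IsWeight w) (u : Lp ℝ 2 (weightMeasure w)) :
    AEStronglyMeasurable u volume :=
  (Lp.aestronglyMeasurable u).mono_ac hw.absolutelyContinuous

/-- Here `|u| ≤ w * u ^ 2 + w⁻¹`, with both terms on the right locally integrable. -/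
lemma IsA2.locallyIntegrable_coe (hw : IsA2 w) (u : Lp ℝ 2 (weightMeasure w)) :
    LocallyIntegrable u volume := by
  refine ((hw.weight.integrable_sq u).locallyIntegrable.add hw.weight_inv.1).mono
    (hw.weight.aestronglyMeasurable_coe u) ?_
  filter_upwards [hw.weight.2] with x hx
  have h1 : w x * u x ^ 2 + (w x)⁻¹ - |u x|
      = ((w x * |u x| - 1 / 2) ^ 2 + 3 / 4) * (w x)⁻¹ := by
    rw [← sq_abs (u x)]; field_simp; ring
  have h2 : 0 ≤ ((w x * |u x| - 1 / 2) ^ 2 + 3 / 4) * (w x)⁻¹ := by positivity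
  rw [Real.norm_eq_abs]
  refine le_trans ?_ (le_abs_self _)
  simp only [Pi.add_apply]
  linarith

lemma IsWeight.locallyIntegrable_mul_coe (hw : IsWeight w) (u : Lp ℝ 2 (weightMeasure w)) :
    LocallyIntegrable (fun x => w x * u x) volume := by
  refine ((hw.integrable_sq u).locallyIntegrable.add hw.1).mono
    (hw.1.aestronglyMeasurable.mul (hw.aestronglyMeasurable_coe u)) ?_
  filter_upwards [hw.2] with x hx
  have h1 : w x * u x ^ 2 + w x - w x * |u x| = ((|u x| - 1 / 2) ^ 2 + 3 / 4) * w x := by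
    rw [← sq_abs (u x)]; ring
  have h2 : 0 ≤ ((|u x| - 1 / 2) ^ 2 + 3 / 4) * w x := by positivity
  rw [Real.norm_eq_abs, abs_mul, abs_of_pos hx]
  refine le_trans ?_ (le_abs_self _)
  simp only [Pi.add_apply]
  linarith

lemma integral_mul_ind (u : ℝ → ℝ) (I : DyadicInterval) :
    ∫ x, u x * (ind I : ℝ → ℝ) x = ∫ x in I.toSet, u x := by
  rw [← integral_indicator I.measurableSet_toSet]
  congr 1
  ext x
  by_cases hx : x ∈ I.toSet <;> simp [ind, hx]

lemma IsWeight.eq_zero_of_inner_toL2 (hw : IsWeight w) {u : Lp ℝ 2 (weightMeasure w)}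
    (h : ∀ f, inner ℝ u (hw.toL2 f) = 0) : u = 0 := by
  have h1 := ae_eq_zero_of_setIntegral_toSet (hw.locallyIntegrable_mul_coe u) fun I => by
    rw [← integral_mul_ind, ← hw.inner_toL2, h]
  rw [Lp.eq_zero_iff_ae_eq_zero]
  refine (weightMeasure_absolutelyContinuous w).ae_le ?_
  filter_upwards [h1, hw.2] with x hx hx'
  exact (mul_eq_zero.1 hx).resolve_left hx'.ne'

lemma IsA2.eq_zero_of_inner_dualToL2 (hw : IsA2 w) {u : Lp ℝ 2 (weightMeasure w)}
    (h : ∀ g, inner ℝ u (hw.dualToL2 g) = 0) : u = 0 := by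
  have h1 := ae_eq_zero_of_setIntegral_toSet (hw.locallyIntegrable_coe u) fun I => by
    rw [← integral_mul_ind, ← hw.inner_dualToL2, h]
  rw [Lp.eq_zero_iff_ae_eq_zero]
  exact (weightMeasure_absolutelyContinuous w).ae_le h1

end WeightedSpace

section Extension

variable {V H : Type*} [AddCommGroup V] [Module ℝ V] [NormedAddCommGroup H]
  [InnerProductSpace ℝ H] [CompleteSpace H]

lemma denseRange_of_eq_zero_of_inner {e : V →ₗ[ℝ] H}
    (he : ∀ u, (∀ v, inner ℝ u (e v) = 0) → u = 0) : DenseRange e := by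
  change Dense (LinearMap.range e : Set H)
  rw [Submodule.dense_iff_topologicalClosure_eq_top, Submodule.topologicalClosure_eq_top_iff,
    Submodule.eq_bot_iff]
  intro u hu
  refine he u fun v => ?_
  rw [real_inner_comm]
  exact hu _ ⟨v, rfl⟩

/-- A bilinear form that is bounded with respect to two maps with dense ranges in a Hilbert space
is given by a unique bounded operator. -/
lemma exists_unique_operator {e d : V →ₗ[ℝ] H}
    (he : ∀ u, (∀ v, inner ℝ u (e v) = 0) → u = 0)
    (hd : ∀ u, (∀ v, inner ℝ u (d v) = 0) → u = 0) (T : V →ₗ[ℝ] V →ₗ[ℝ] ℝ) {N : ℝ}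
    (hT : ∀ v v', |T v v'| ≤ N * ‖e v‖ * ‖d v'‖) :
    ∃! U : H →L[ℝ] H, (∀ v v', inner ℝ (U (e v)) (d v') = T v v') ∧ ∀ x, ‖U x‖ ≤ N * ‖x‖ := by
  have hed := denseRange_of_eq_zero_of_inner he
  have hdd := denseRange_of_eq_zero_of_inner hd
  have hex : ∀ v, ∃ u : H, (∀ v', inner ℝ u (d v') = T v v') ∧ ‖u‖ ≤ N * ‖e v‖ := by
    intro v
    refine ⟨(InnerProductSpace.toDual ℝ H).symm ((T v).extendOfNorm d), fun v' => ?_, ?_⟩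
    · rw [InnerProductSpace.toDual_symm_apply, LinearMap.extendOfNorm_eq hdd ⟨_, hT v⟩]
    · rw [LinearIsometryEquiv.norm_map]
      by_cases hN : 0 ≤ N * ‖e v‖
      · exact LinearMap.opNorm_extendOfNorm_le hdd hN (hT v)
      · -- a negative bound is only possible when `d = 0`, and then `H` is trivial
        have h0 : ∀ v', d v' = 0 := fun v' => by
          by_contra h
          have := norm_pos_iff.2 h
          have := (abs_nonneg _).trans (hT v v')
          exact hN (nonneg_of_mul_nonneg_left this ‹_›)
        have h1 : e v = 0 := hd _ fun v' => by rw [h0, inner_zero_right]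
        simp [h1] at hN
  choose S hS1 hS2 using hex
  have huniq : ∀ u u' : H, (∀ v, inner ℝ u (d v) = inner ℝ u' (d v)) → u = u' := fun u u' h =>
    sub_eq_zero.1 (hd _ fun v => by rw [inner_sub_left, h, sub_self])
  let S' : V →ₗ[ℝ] H :=
    { toFun := S
      map_add' := fun v v' => huniq _ _ fun z => by simp [inner_add_left, hS1]
      map_smul' := fun c v => huniq _ _ fun z => by simp [real_inner_smul_left, hS1] }
  have hU : ∀ v, S'.extendOfNorm e (e v) = S v := LinearMap.extendOfNorm_eq hed ⟨N, hS2⟩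
  refine ⟨S'.extendOfNorm e, ⟨fun v v' => by rw [hU, hS1],
    LinearMap.norm_extendOfNorm_apply_le hed N hS2⟩, fun U' hU' => ?_⟩
  refine ContinuousLinearMap.ext fun x => congrFun (hed.equalizer U'.continuous
    (S'.extendOfNorm e).continuous (funext fun v => ?_)) x
  simp only [Function.comp_apply]
  rw [hU]
  exact huniq _ _ fun z => by rw [hU'.1, hS1]

end Extension

lemma IsA2.extends_iff {w : ℝ → ℝ} (hw : IsA2 w)
    (U : Lp ℝ 2 (weightMeasure w) →L[ℝ] Lp ℝ 2 (weightMeasure w)) (T : DyadicOperator) :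
    Extends w U T ↔ ∀ f g, inner ℝ (U (hw.weight.toL2 f)) (hw.dualToL2 g) = T f g := by
  simp only [hw.inner_dualToL2]
  refine ⟨fun h f g => ?_, fun h f => ⟨hw.weight.memLp_coe f, fun g =>
    ⟨integrable_mul_coe (hw.locallyIntegrable_coe _) g, (h f g).symm⟩⟩⟩
  obtain ⟨_, hf⟩ := h f
  exact (hf g).2.symm

end PerfectDyadic

end

open PerfectDyadic in
theorem theorem4p3 :
    ∃ C : ℝ, ∀ (T : DyadicOperator) (Q : ℝ), IsPerfectDyadicOperator T →
      bmoNorm (oneCoeff T) ≤ ENNReal.ofReal Q →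
      bmoNorm (oneCoeff T.flip) ≤ ENNReal.ofReal Q →
      (∀ I : DyadicInterval, |T (haar I) (haar I)| ≤ Q) →
      ∀ w : ℝ → ℝ, IsA2 w →
        ∃! U : Lp ℝ 2 (weightMeasure w) →L[ℝ] Lp ℝ 2 (weightMeasure w),
          Extends w U T ∧
            ∀ f : Lp ℝ 2 (weightMeasure w), ‖U f‖ ≤ C * Q * A2const w * ‖f‖ := by
  refine ⟨1024, fun T Q hT hb hc hd w hw => ?_⟩
  have hQ : 0 ≤ Q := (abs_nonneg _).trans (hd ⟨0, 0⟩)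
  simp only [hw.extends_iff]
  refine exists_unique_operator (fun u => hw.weight.eq_zero_of_inner_toL2)
    (fun u => hw.eq_zero_of_inner_dualToL2) T fun f g => ?_
  rw [hw.weight.norm_toL2, hw.norm_dualToL2]
  exact abs_pairing_le hT hQ hb hc hd hw f g
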